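/- **Setting.** For a complex sequence $a=(a_j)_{j\in\mathbb Z}$ let $T_n(a)=(a_{i-j})_{i,j=1}^n$ be the $n\times n$ Toeplitz matrix with input $a$. Let $P_n=(\delta_{i+j,\,n+1})_{i,j=1}^n$ be the backward identity matrix, and let $H_{n,s}(a)=P_nT_n(a)$ be the symmetric Hankel matrix with input $a$. For an $n\times n$ random matrix $B$ with entries having all moments finite, put $\varphi_n(B)=\frac1n\mathbf E[\operatorname{Tr}B]$. A $*$-probability space is a pair $(\mathcal A,\varphi)$ of a unital complex $*$-algebra and a linear functional $\varphi$ with $\varphi(\mathbf 1)=1$ and $\varphi(xx^*)\ge 0$ for all $x\in\mathcal A$. A family $(A_{\iota,n})_\iota$ of sequences of $n\times n$ random matrices, with entries having all moments finite, *converges jointly in $*$-distribution* if there are a $*$-probability space $(\mathcal A,\varphi)$ and elements $x_\iota\in\mathcal A$ such that $$\lim_{n\to\infty}\varphi_n\big(A_{\iota_1,n}^{\epsilon_1}\cdots A_{\iota_k,n}^{\epsilon_k}\big)=\varphi\big(x_{\iota_1}^{\epsilon_1}\cdots x_{\iota_k}^{\epsilon_k}\big)$$ for all $k\ge1$, all indices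 $\iota_1,\dots,\iota_k$ and all $\epsilon_1,\dots,\epsilon_k\in\{1,*\}$, where $*$ on matrices is the conjugate transpose. **Random inputs.** An array $a_{j,n}=x_{j,n}+\mathrm i\,y_{j,n}$ ($n\ge1$, $j\in\mathbb Z$) of complex random variables is called *pair-correlated* if $\mathbf E\,a_{j,n}=0$; for every $n\ge 1$ the vectors $(x_{j,n},x_{-j,n},y_{j,n},y_{-j,n})$, $j\ge0$, are independent; and there are real constants $\sigma_x,\sigma_y,\rho_1,\dots,\rho_6$ and $(c_k)_{k\ge1}$ such that, for all $n\ge1$: 1. $\mathbf E[x_{j,n}^2]=\sigma_x^2$ and $\mathbf E[y_{j,n}^2]=\sigma_y^2$ for all $j\in\mathbb Z$; 2. for all $j\ge1$: $\mathbf E[x_{j,n}y_{j,n}]=\rho_1$, $\mathbf E[x_{j,n}x_{-j,n}]=\rho_2$, $\mathbf E[x_{j,n}y_{-j,n}]=\rho_3$, $\mathbf E[x_{-j,n}y_{j,n}]=\rho_4$, $\mathbf E[y_{j,n}y_{-j,n}]=\rho_5$, $\mathbf E[x_{-j,n}y_{-j,n}]=\rho_6$; 3. $\mathbf E|x_{j,n}|^k\le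 c_k<\infty$ and $\mathbf E|y_{j,n}|^k\le c_k<\infty$ for all $j\in\mathbb Z$ and $k\ge1$. **Corollary 2.1.** Let $u^{(1)},\dots,u^{(r)}$ be pair-correlated arrays on one probability space, each with its own constants, such that for every $n\ge1$ the sequences $(u^{(k)}_{j,n})_{j\in\mathbb Z}$, $1\le k\le r$, are independent. Let $t,h:\{1,\dots,m\}\to\{1,\dots,r\}$ be injective, and let $T_n^{(i)}$ be the Toeplitz matrix with input $(u^{(t(i))}_{j,n})_j$ and $H_{n,s}^{(i)}$ the symmetric Hankel matrix with input $(u^{(h(i))}_{j,n})_j$, $1\le i\le m$. (So the $T_n^{(i)}$ are independent and the $H_{n,s}^{(i)}$ are independent; the two families are independent of each other if $t$ and $h$ have disjoint ranges, and they may also share inputs.) Let $D_n^{(i)}=T_n(d^{(i)})$ and $\tilde H_{n,s}^{(i)}=H_{n,s}(e^{(i)})$, $1\le i\le m$, be deterministic Toeplitz and deterministic symmetric Hankel matrices, where $d^{(i)}$ and $e^{(i)}$ are complex sequences (not depending on $n$) with $\sum_{k\in\mathbb Z}|d^{(i)}_k|<\infty$ and $\sum_{k\in\mathbb Z}|e^{(i)}_k|<\infty$.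 Then the whole family $$\big\{\,n^{-1/2}T_n^{(i)},\ n^{-1/2}H_{n,s}^{(i)},\ D_n^{(i)},\ \tilde H_{n,s}^{(i)},\ P_n\ ;\ 1\le i\le m\,\big\}$$ converges jointly in $*$-distribution as $n\to\infty$; in particular, so does every subfamily. -/

import Mathlib

open MeasureTheory ProbabilityTheory Filter Topology

noncomputable section

namespace ToeplitzHankel

/-- The `n × n` Toeplitz matrix with input sequence `a`: the `(i, j)` entry is `a (i - j)`. -/
def toeplitz (a : ℤ → ℂ) (n : ℕ) : Matrix (Fin n) (Fin n) ℂ :=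
  Matrix.of fun i j => a (((i : ℕ) : ℤ) - ((j : ℕ) : ℤ))

/-- The backward identity permutation matrix: ones on the anti-diagonal, zeros elsewhere
(indices run through `0, …, n - 1`). -/
def backwardIdentity (n : ℕ) : Matrix (Fin n) (Fin n) ℂ :=
  Matrix.of fun i j => if (i : ℕ) + (j : ℕ) + 1 = n then 1 else 0

/-- The symmetric Hankel matrix with input sequence `a`, the product of the backward identity and
the Toeplitz matrix with input sequence `a`. -/
def symmHankel (a : ℤ → ℂ) (n : ℕ) : Matrix (Fin n) (Fin n) ℂ :=
  backwardIdentity n * toeplitz a n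

/-- The second order parameters of a pair-correlated input sequence. -/
structure CorrParams where
  sigmaX : ℝ
  sigmaY : ℝ
  rho1 : ℝ
  rho2 : ℝ
  rho3 : ℝ
  rho4 : ℝ
  rho5 : ℝ
  rho6 : ℝ

variable {Ω : Type*} [MeasurableSpace Ω]

/-- A triangular array `a n j = x n j + i y n j` (`n ≥ 1`, `j ∈ ℤ`) of centered complex random
variables whose pairs `(a n j, a n (-j))`, `j ≥ 0`, are independent for every `n`, with
second moments that depend neither on `n` nor on `j`, and with all moments uniformly bounded. -/
structure IsPairCorrelated (μ : Measure Ω) (a : ℕ → ℤ → Ω → ℂ) (q : CorrParams) : Prop where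
  measurable : ∀ n, 1 ≤ n → ∀ j, Measurable (a n j)
  mean_zero : ∀ n, 1 ≤ n → ∀ j, ∫ ω, a n j ω ∂μ = 0
  indep : ∀ n, 1 ≤ n →
    iIndepFun (fun (j : ℕ) (ω : Ω) => (a n (j : ℤ) ω, a n (-(j : ℤ)) ω)) μ
  sq_x : ∀ n, 1 ≤ n → ∀ j, ∫ ω, (a n j ω).re ^ 2 ∂μ = q.sigmaX ^ 2
  sq_y : ∀ n, 1 ≤ n → ∀ j, ∫ ω, (a n j ω).im ^ 2 ∂μ = q.sigmaY ^ 2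
  corr1 : ∀ n, 1 ≤ n → ∀ j, 1 ≤ j → ∫ ω, (a n j ω).re * (a n j ω).im ∂μ = q.rho1
  corr2 : ∀ n, 1 ≤ n → ∀ j, 1 ≤ j → ∫ ω, (a n j ω).re * (a n (-j) ω).re ∂μ = q.rho2
  corr3 : ∀ n, 1 ≤ n → ∀ j, 1 ≤ j → ∫ ω, (a n j ω).re * (a n (-j) ω).im ∂μ = q.rho3
  corr4 : ∀ n, 1 ≤ n → ∀ j, 1 ≤ j → ∫ ω, (a n (-j) ω).re * (a n j ω).im ∂μ = q.rho4
  corr5 : ∀ n, 1 ≤ n → ∀ j, 1 ≤ j → ∫ ω, (a n j ω).im * (a n (-j) ω).im ∂μ = q.rho5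
  corr6 : ∀ n, 1 ≤ n → ∀ j, 1 ≤ j → ∫ ω, (a n (-j) ω).re * (a n (-j) ω).im ∂μ = q.rho6
  moments : ∃ c : ℕ → ℝ, ∀ k, 1 ≤ k → ∀ n, 1 ≤ n → ∀ j,
    Integrable (fun ω => |(a n j ω).re| ^ k) μ ∧ ∫ ω, |(a n j ω).re| ^ k ∂μ ≤ c k ∧
    Integrable (fun ω => |(a n j ω).im| ^ k) μ ∧ ∫ ω, |(a n j ω).im| ^ k ∂μ ≤ c k

/-- The state `φₙ(B) = (1/n) E[Tr B]` on `n × n` random matrices. -/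
def expTrace (μ : Measure Ω) {n : ℕ} (B : Ω → Matrix (Fin n) (Fin n) ℂ) : ℂ :=
  (n : ℂ)⁻¹ * ∫ ω, (B ω).trace ∂μ

/-- All entries of the random matrix have finite moments of all orders. -/
def HasAllMoments (μ : Measure Ω) {n : ℕ} (B : Ω → Matrix (Fin n) (Fin n) ℂ) : Prop :=
  ∀ i j, ∀ p : ℕ, MemLp (fun ω => B ω i j) (p : ENNReal) μ

/-- A state on a unital `*`-algebra: a linear functional `φ` with `φ(1) = 1` and `φ(x x*) ≥ 0`. -/
structure IsState {𝒜 : Type*} [Ring 𝒜] [StarRing 𝒜] [Algebra ℂ 𝒜] (φ : 𝒜 →ₗ[ℂ] ℂ) : Prop where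
  map_one : φ 1 = 1
  nonneg : ∀ x : 𝒜, ∃ r : ℝ, 0 ≤ r ∧ φ (x * star x) = (r : ℂ)

/-- The word `x_{i₁}^{ε₁} ⋯ x_{iₖ}^{εₖ}`; the letter `(i, false)` stands for `x i` and the letter
`(i, true)` for `(x i)*`. -/
def starWord {ι : Type*} {R : Type*} [Monoid R] [Star R] (x : ι → R) (w : List (ι × Bool)) : R :=
  (w.map fun l => if l.2 then star (x l.1) else x l.1).prod

/-- Joint convergence in `*`-distribution of a family of sequences of random matrices (with finite
moments) to a family of elements of some `*`-probability space `(𝒜, φ)`. -/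
def ConvergeJointly {ι : Type*} (μ : Measure Ω)
    (A : ι → (n : ℕ) → Ω → Matrix (Fin n) (Fin n) ℂ) : Prop :=
  (∀ i n, 1 ≤ n → HasAllMoments μ (A i n)) ∧
  ∃ (𝒜 : Type) (_ : Ring 𝒜) (_ : StarRing 𝒜) (_ : Algebra ℂ 𝒜) (_ : StarModule ℂ 𝒜)
    (φ : 𝒜 →ₗ[ℂ] ℂ) (x : ι → 𝒜), IsState φ ∧
    ∀ w : List (ι × Bool),
      Tendsto (fun n : ℕ => expTrace μ (fun ω => starWord (fun i => A i n ω) w)) atTop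
        (𝓝 (φ (starWord x w)))

/-- Labels of the `4 m + 1` sequences of matrices. -/
inductive Label (m : ℕ) : Type
  | randToeplitz (i : Fin m)
  | randHankel (i : Fin m)
  | detToeplitz (i : Fin m)
  | detHankel (i : Fin m)
  | backward

/-- The scaled random Toeplitz matrices with inputs `a i`, the scaled random symmetric Hankel
matrices with inputs `b i`, the deterministic Toeplitz matrices with inputs `d i`, the deterministic
symmetric Hankel matrices with inputs `e i`, and the backward identity. -/
def collection {m : ℕ} (a b : Fin m → ℕ → ℤ → Ω → ℂ) (d e : Fin m → ℤ → ℂ) :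
    Label m → (n : ℕ) → Ω → Matrix (Fin n) (Fin n) ℂ
  | .randToeplitz i, n, ω => ((Real.sqrt n : ℝ) : ℂ)⁻¹ • toeplitz (fun j => a i n j ω) n
  | .randHankel i, n, ω => ((Real.sqrt n : ℝ) : ℂ)⁻¹ • symmHankel (fun j => b i n j ω) n
  | .detToeplitz i, n, _ => toeplitz (d i) n
  | .detHankel i, n, _ => symmHankel (e i) n
  | .backward, n, _ => backwardIdentity n

end ToeplitzHankel

end

/-! Write `T(c)` for a Toeplitz matrix and `P` for the backward identity. Since `P T(c) = T(c
reflected) P`, `P² = 1` and `P* = P`, every `*`-word in the family is a product of Toeplitz matrices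
followed by at most one `P` (`hasNormalForm_starWord`). Expanding each factor into its diagonals
turns the normalized expected trace into a sum over one index per factor and the starting point `i`
of a path. The terms are deterministic coefficients times a joint moment of the random inputs, and
the path must stay in `[0, n)` and end at `i`, or at `n - 1 - i` if a `P` is left over
(`expTrace_prod_eq`).

Fix the deterministic indices and sort the `N` random indices by their signs and the order of their
absolute values. If some absolute value occurs only once, the moment is zero by independence and
centering. A class with `k` distinct nonzero absolute values has `O(n^(k+1))` terms against the
normalization `n^(1+N/2)`, so only classes with `N = 2k`, where the absolute values occur exactly in
pairs, can survive. On such a class the moment is constant, because second moments depend only on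
the signs, and the admissible indices are the integer points of polyhedra in `k + 1` variables whose
constraints are affine in `n`. Their number divided by `n^(k+1)` converges (`IsPoly.tendsto_card`,
`IsMomentFunction.tendsto_momentSum`).

The inner sums are bounded uniformly in the deterministic indices, so absolute summability of the
deterministic inputs permits dominated convergence (`tendsto_expTrace_prod`). The limits of all
words define a functional on the free `*`-algebra that inherits normalization and positivity
(`convergeJointly_of_tendsto`). -/

open MeasureTheory ProbabilityTheory Filter Topology

noncomputable section

namespace ToeplitzHankel

/-! ### Counting integer points in polyhedra that grow with `n`. -/

section LatticeCount

variable {ι : Type*} [Fintype ι]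

/-- An integer affine form in the lattice variables and the scale `n`. -/
def IsAffine (g : ℕ → (ι → ℤ) → ℤ) : Prop :=
  ∃ (a : ι → ℤ) (α β : ℤ), ∀ n x, g n x = ∑ i, a i * x i + α * n + β

/-- A family of lattice polyhedra cut out by finitely many integer affine inequalities in the
lattice variables and the scale `n`. -/
def IsPoly (Q : ℕ → (ι → ℤ) → Prop) : Prop :=
  ∃ C : List ((ι → ℤ) × ℤ × ℤ), ∀ n x, Q n x ↔
    ∀ c ∈ C, ∑ i, c.1 i * x i ≤ c.2.1 * n + c.2.2

theorem IsAffine.const (c : ℤ) : IsAffine (fun _ (_ : ι → ℤ) => c) :=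
  ⟨0, 0, c, fun n x => by simp⟩

theorem IsAffine.scale : IsAffine (fun n (_ : ι → ℤ) => (n : ℤ)) :=
  ⟨0, 1, 0, fun n x => by simp⟩

theorem IsAffine.coord (i : ι) : IsAffine (fun _ (x : ι → ℤ) => x i) := by
  classical
  exact ⟨Pi.single i 1, 0, 0, fun n x => by simp [Pi.single_apply]⟩

theorem IsAffine.add {g g' : ℕ → (ι → ℤ) → ℤ} (hg : IsAffine g) (hg' : IsAffine g') :
    IsAffine (fun n x => g n x + g' n x) := by
  obtain ⟨a, α, β, h⟩ := hg
  obtain ⟨a', α', β', h'⟩ := hg'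
  refine ⟨a + a', α + α', β + β', fun n x => ?_⟩
  simp only [h, h', Pi.add_apply, add_mul, Finset.sum_add_distrib]
  ring

theorem IsAffine.const_mul {g : ℕ → (ι → ℤ) → ℤ} (c : ℤ) (hg : IsAffine g) :
    IsAffine (fun n x => c * g n x) := by
  obtain ⟨a, α, β, h⟩ := hg
  refine ⟨fun i => c * a i, c * α, c * β, fun n x => ?_⟩
  simp only [h, mul_add, Finset.mul_sum, mul_assoc]

theorem IsAffine.sub {g g' : ℕ → (ι → ℤ) → ℤ} (hg : IsAffine g) (hg' : IsAffine g') :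
    IsAffine (fun n x => g n x - g' n x) := by
  convert hg.add (hg'.const_mul (-1)) using 3
  ring

theorem IsAffine.sum {κ : Type*} (s : Finset κ) {g : κ → ℕ → (ι → ℤ) → ℤ}
    (hg : ∀ k, IsAffine (g k)) : IsAffine (fun n x => ∑ k ∈ s, g k n x) := by
  classical
  induction s using Finset.induction_on with
  | empty => simpa using IsAffine.const (ι := ι) 0
  | insert k s hk ih => simpa [Finset.sum_insert hk] using (hg k).add ih

theorem IsPoly.true : IsPoly (fun _ (_ : ι → ℤ) => True) := ⟨[], fun n x => by simp⟩

theorem IsPoly.and {Q Q' : ℕ → (ι → ℤ) → Prop} (hQ : IsPoly Q) (hQ' : IsPoly Q') :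
    IsPoly (fun n x => Q n x ∧ Q' n x) := by
  obtain ⟨C, h⟩ := hQ
  obtain ⟨C', h'⟩ := hQ'
  refine ⟨C ++ C', fun n x => ?_⟩
  simp only [h, h', List.forall_mem_append]

theorem IsPoly.le {g g' : ℕ → (ι → ℤ) → ℤ} (hg : IsAffine g) (hg' : IsAffine g') :
    IsPoly (fun n x => g n x ≤ g' n x) := by
  obtain ⟨a, α, β, h⟩ := hg.sub hg'
  refine ⟨[(a, -α, -β)], fun n x => ?_⟩
  have := h n x
  simp only [List.mem_singleton, forall_eq]
  constructor <;> intro h <;> linarith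

/-- Over the integers a strict inequality becomes a weak one after a shift by one, so closed
half-spaces suffice. -/
theorem IsPoly.lt {g g' : ℕ → (ι → ℤ) → ℤ} (hg : IsAffine g) (hg' : IsAffine g') :
    IsPoly (fun n x => g n x < g' n x) := by
  simpa only [Int.lt_iff_add_one_le] using IsPoly.le (hg.add (IsAffine.const 1)) hg'

theorem IsPoly.eq {g g' : ℕ → (ι → ℤ) → ℤ} (hg : IsAffine g) (hg' : IsAffine g') :
    IsPoly (fun n x => g n x = g' n x) := by
  simpa only [le_antisymm_iff] using (IsPoly.le hg hg').and (IsPoly.le hg' hg)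

theorem IsPoly.forall_list {κ : Type*} (l : List κ) {Q : κ → ℕ → (ι → ℤ) → Prop}
    (hQ : ∀ k, IsPoly (Q k)) : IsPoly (fun n x => ∀ k ∈ l, Q k n x) := by
  induction l with
  | nil => simpa using IsPoly.true (ι := ι)
  | cons k l ih => simpa using (hQ k).and ih

theorem IsPoly.forall {κ : Type*} [Fintype κ] {Q : κ → ℕ → (ι → ℤ) → Prop}
    (hQ : ∀ k, IsPoly (Q k)) : IsPoly (fun n x => ∀ k, Q k n x) := by
  simpa using IsPoly.forall_list (Finset.univ : Finset κ).toList hQ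

theorem IsPoly.comp {κ : Type*} [Fintype κ] {Q : ℕ → (κ → ℤ) → Prop} (hQ : IsPoly Q)
    {g : κ → ℕ → (ι → ℤ) → ℤ} (hg : ∀ k, IsAffine (g k)) :
    IsPoly (fun n x => Q n (fun k => g k n x)) := by
  obtain ⟨C, h⟩ := hQ
  simp only [h]
  exact IsPoly.forall_list C fun c =>
    IsPoly.le (IsAffine.sum _ fun k => (hg k).const_mul _)
      ((IsAffine.scale.const_mul _).add (IsAffine.const _))

/-- The lattice points of the cube `[-n, n]^ι`. -/
def box (ι : Type*) [Fintype ι] (n : ℕ) : Finset (ι → ℤ) := by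
  classical exact Fintype.piFinset fun _ => Finset.Icc (-(n : ℤ)) n

theorem mem_box {n : ℕ} {x : ι → ℤ} : x ∈ box ι n ↔ ∀ i, -(n : ℤ) ≤ x i ∧ x i ≤ n := by
  classical
  simp [box, Fintype.mem_piFinset]

theorem card_box (n : ℕ) : (box ι n).card = (2 * n + 1) ^ Fintype.card ι := by
  classical
  have : ((n : ℤ) + 1 - -n).toNat = 2 * n + 1 := by omega
  rw [box, Fintype.card_piFinset, Finset.prod_const, Finset.card_univ, Int.card_Icc, this]

open Classical in
/-- A slab of bounded width contains few lattice points of the cube. -/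
theorem card_slab_le (a : ι → ℤ) (ha : a ≠ 0) (α β : ℤ) (n : ℕ) :
    ((box ι n).filter fun x => |∑ i, a i * x i - α * n| ≤ |β|).card
      ≤ (2 * n + 1) ^ (Fintype.card ι - 1) * (2 * β.natAbs + 1) := by
  obtain ⟨i₀, hi₀⟩ := Function.ne_iff.1 ha
  -- As `a i₀ ≠ 0`, the coordinate `x i₀` is recovered from the other coordinates and the value of
  -- the form, which takes at most `2 |β| + 1` values.
  let φ : (ι → ℤ) → ({i // i ≠ i₀} → ℤ) × ℤ := fun x =>
    (fun i => x i, ∑ i, a i * x i - α * n)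
  have hcard : ((box {i // i ≠ i₀} n) ×ˢ Finset.Icc (-|β|) |β|).card
      = (2 * n + 1) ^ (Fintype.card ι - 1) * (2 * β.natAbs + 1) := by
    rw [Finset.card_product, card_box]
    congr 2
    · simp [Fintype.card_subtype_compl]
    · rw [Int.card_Icc, Int.abs_eq_natAbs]; omega
  rw [← hcard]
  refine Finset.card_le_card_of_injOn φ ?_ ?_
  · intro x hx
    simp only [Finset.coe_filter, Set.mem_ofPred_eq, mem_box] at hx
    simp only [Finset.coe_product, Set.mem_prod, Finset.mem_coe, mem_box, Finset.mem_Icc, φ]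
    exact ⟨fun i => hx.1 i, abs_le.1 hx.2⟩
  · intro x _ y _ hxy
    simp only [φ, Prod.mk.injEq] at hxy
    have h1 : ∀ i, i ≠ i₀ → x i = y i := fun i hi => congrFun hxy.1 ⟨i, hi⟩
    have h2 : ∑ i, a i * x i = ∑ i, a i * y i := by linarith [hxy.2]
    rw [← Finset.add_sum_erase _ _ (Finset.mem_univ i₀),
      ← Finset.add_sum_erase Finset.univ (fun i => a i * y i) (Finset.mem_univ i₀),
      Finset.sum_congr rfl fun i hi => by rw [h1 i (Finset.ne_of_mem_erase hi)]] at h2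
    have h3 : x i₀ = y i₀ := mul_left_cancel₀ hi₀ (add_right_cancel h2)
    funext i
    by_cases hi : i = i₀
    · rw [hi, h3]
    · exact h1 i hi

/-- `(2 n + 1)^k` divided by a higher power of `n` tends to zero. -/
theorem tendsto_pow_div_pow {k d : ℕ} (hkd : k < d) :
    Tendsto (fun n : ℕ => ((2 * n + 1 : ℕ) : ℝ) ^ k / (n : ℝ) ^ d) atTop (𝓝 0) := by
  have h1 : Tendsto (fun n : ℕ => (3 : ℝ) ^ k * ((n : ℝ)⁻¹)) atTop (𝓝 0) := by
    simpa using (tendsto_inv_atTop_nhds_zero_nat (𝕜 := ℝ)).const_mul ((3 : ℝ) ^ k)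
  refine squeeze_zero' (Eventually.of_forall fun n => by positivity) ?_ h1
  filter_upwards [eventually_ge_atTop 1] with n hn
  have hn' : (1 : ℝ) ≤ n := by exact_mod_cast hn
  have h2 : ((2 * n + 1 : ℕ) : ℝ) ^ k ≤ (3 * n) ^ k := by
    gcongr; push_cast; linarith
  have h3 : (n : ℝ) ^ (k + 1) ≤ (n : ℝ) ^ d := pow_le_pow_right₀ hn' hkd
  rw [div_le_iff₀ (by positivity)]
  calc ((2 * n + 1 : ℕ) : ℝ) ^ k ≤ (3 * n) ^ k := h2
    _ = 3 ^ k * (n : ℝ)⁻¹ * n ^ (k + 1) := by rw [mul_pow, pow_succ]; field_simp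
    _ ≤ _ := by gcongr

-- Without constant terms, division by `n` carries these lattice points to the points of `n⁻¹ ℤ^ι`
-- in one fixed polytope. A convex set has a null frontier, so the normalized count tends to its
-- volume.
open Classical in
theorem tendsto_card_homogeneous (C : List ((ι → ℤ) × ℤ × ℤ)) :
    ∃ L : ℝ, Tendsto (fun n : ℕ => (((box ι n).filter fun x =>
      ∀ c ∈ C, ∑ i, c.1 i * x i ≤ c.2.1 * n).card : ℝ) / (n : ℝ) ^ Fintype.card ι)
      atTop (𝓝 L) := by
  let s : Set (ι → ℝ) := Set.Icc (-1) 1 ∩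
    ⋂ c ∈ {c | c ∈ C}, {x : ι → ℝ | ∑ i, (c.1 i : ℝ) * x i ≤ c.2.1}
  have hclosed : IsClosed s := by
    refine isClosed_Icc.inter (isClosed_biInter fun c _ => ?_)
    exact isClosed_le (by fun_prop) continuous_const
  have hbdd : Bornology.IsBounded s :=
    (Metric.isBounded_Icc (-1 : ι → ℝ) 1).subset Set.inter_subset_left
  have hconv : Convex ℝ s := by
    refine (convex_Icc _ _).inter (convex_iInter₂ fun c _ => ?_)
    refine convex_halfSpace_le ⟨fun x y => ?_, fun r x => ?_⟩ _
    · simp [mul_add, Finset.sum_add_distrib]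
    · simp only [Pi.smul_apply, smul_eq_mul, Finset.mul_sum]
      exact Finset.sum_congr rfl fun i _ => by ring
  have hlim := tendsto_card_div_pow_atTop_volume s hbdd hclosed.measurableSet
    (hconv.addHaar_frontier volume)
  refine ⟨_, hlim.congr' ?_⟩
  filter_upwards [eventually_ge_atTop 1] with n hn
  have hn0 : (0 : ℝ) < n := by exact_mod_cast hn
  congr 2
  rw [← Nat.card_eq_finsetCard]
  symm
  refine Nat.card_congr (Equiv.ofBijective (fun x => ⟨fun i => (n : ℝ)⁻¹ * (x.1 i : ℝ), ?_, ?_⟩)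
    ⟨?_, ?_⟩)
  · have hx := x.2
    simp only [Finset.mem_filter, mem_box] at hx
    refine ⟨⟨fun i => ?_, fun i => ?_⟩, Set.mem_iInter₂.2 fun c hc => ?_⟩
    · have : (-(n : ℝ)) ≤ x.1 i := by exact_mod_cast (hx.1 i).1
      change -1 ≤ (n : ℝ)⁻¹ * (x.1 i : ℝ)
      rw [inv_mul_eq_div, le_div_iff₀ hn0]
      linarith
    · have : (x.1 i : ℝ) ≤ n := by exact_mod_cast (hx.1 i).2
      change (n : ℝ)⁻¹ * (x.1 i : ℝ) ≤ 1
      rw [inv_mul_eq_div, div_le_iff₀ hn0]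
      linarith
    · have : (∑ i, (c.1 i : ℝ) * x.1 i) ≤ c.2.1 * n := by exact_mod_cast hx.2 c hc
      rw [Set.mem_ofPred_eq]
      have e : ∑ i, (c.1 i : ℝ) * ((n : ℝ)⁻¹ * x.1 i) = (n : ℝ)⁻¹ * ∑ i, (c.1 i : ℝ) * x.1 i := by
        rw [Finset.mul_sum]
        exact Finset.sum_congr rfl fun i _ => by ring
      rw [e, inv_mul_eq_div, div_le_iff₀ hn0]
      exact this
  · refine Set.mem_smul_set.2 ⟨fun i => (x.1 i : ℝ), ?_, by ext i; simp⟩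
    rw [SetLike.mem_coe, Module.Basis.mem_span_iff_repr_mem]
    intro i
    simp
  · intro x y hxy
    ext i
    have := congrFun (Subtype.ext_iff.1 hxy) i
    simp only [mul_eq_mul_left_iff, Int.cast_inj, inv_eq_zero, hn0.ne', or_false] at this
    exact this
  · rintro ⟨y, hy, hy'⟩
    obtain ⟨z, hz, rfl⟩ := Set.mem_smul_set.1 hy'
    rw [SetLike.mem_coe, Module.Basis.mem_span_iff_repr_mem] at hz
    have hz' : ∀ i, ∃ k : ℤ, (k : ℝ) = z i := fun i => by simpa using hz i
    choose x hx using hz'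
    refine ⟨⟨x, ?_⟩, Subtype.ext (by ext i; simp [hx])⟩
    simp only [Finset.mem_filter, mem_box]
    refine ⟨fun i => ⟨?_, ?_⟩, fun c hc => ?_⟩
    · have := hy.1.1 i
      simp only [Pi.neg_apply, Pi.one_apply, Pi.smul_apply, smul_eq_mul, ← hx, inv_mul_eq_div,
        le_div_iff₀ hn0] at this
      have : (-(n : ℝ)) ≤ x i := by linarith
      exact_mod_cast this
    · have := hy.1.2 i
      simp only [Pi.one_apply, Pi.smul_apply, smul_eq_mul, ← hx, inv_mul_eq_div,
        div_le_iff₀ hn0] at this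
      have : (x i : ℝ) ≤ n := by linarith
      exact_mod_cast this
    · have := Set.mem_iInter₂.1 hy.2 c hc
      simp only [Set.mem_ofPred_eq, Pi.smul_apply, smul_eq_mul, ← hx] at this
      have e : ∑ i, (c.1 i : ℝ) * ((n : ℝ)⁻¹ * x i) = (n : ℝ)⁻¹ * ∑ i, (c.1 i : ℝ) * x i := by
        rw [Finset.mul_sum]
        exact Finset.sum_congr rfl fun i _ => by ring
      rw [e, inv_mul_eq_div, div_le_iff₀ hn0] at this
      exact_mod_cast this

open Classical in
/-- The number of lattice points in a family of polyhedra, divided by the natural power of the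
scale, converges. -/
theorem IsPoly.tendsto_card {Q : ℕ → (ι → ℤ) → Prop} (hQ : IsPoly Q) :
    ∃ L : ℝ, Tendsto (fun n : ℕ => (((box ι n).filter fun x => Q n x).card : ℝ) /
      (n : ℝ) ^ Fintype.card ι) atTop (𝓝 L) := by
  obtain ⟨C, hC⟩ := hQ
  -- A constraint without lattice variables is a condition on `n` alone, affine in `n`, hence
  -- eventually violated or eventually satisfied. In the first case the count is eventually zero; in
  -- the second the constraint can be dropped.
  by_cases hbad : ∃ c ∈ C, c.1 = 0 ∧ ∀ᶠ n : ℕ in atTop, c.2.1 * (n : ℤ) + c.2.2 < 0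
  · obtain ⟨c, hc, hc0, hcn⟩ := hbad
    refine ⟨0, tendsto_const_nhds.congr' ?_⟩
    filter_upwards [hcn] with n hn
    rw [Finset.filter_false_of_mem, Finset.card_empty, Nat.cast_zero, zero_div]
    intro x _ hx
    have := (hC n x).1 hx c hc
    simp only [hc0, Pi.zero_apply, zero_mul, Finset.sum_const_zero] at this
    omega
  have hgood : ∀ᶠ n : ℕ in atTop, ∀ c ∈ C, c.1 = 0 → 0 ≤ c.2.1 * (n : ℤ) + c.2.2 := by
    have key : ∀ c ∈ C, ∀ᶠ n : ℕ in atTop, c.1 = 0 → 0 ≤ c.2.1 * (n : ℤ) + c.2.2 := by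
      intro c hc
      by_cases hc0 : c.1 = 0
      swap
      · exact Eventually.of_forall fun n h => absurd h hc0
      have hb : ¬ ∀ᶠ n : ℕ in atTop, c.2.1 * (n : ℤ) + c.2.2 < 0 := fun h =>
        hbad ⟨c, hc, hc0, h⟩
      rcases lt_trichotomy c.2.1 0 with h | h | h
      · refine absurd ?_ hb
        filter_upwards [eventually_ge_atTop (c.2.2.natAbs + 1)] with n hn
        have : (c.2.2.natAbs : ℤ) + 1 ≤ n := by exact_mod_cast hn
        nlinarith [Int.le_natAbs (a := c.2.2)]
      · by_cases h2 : 0 ≤ c.2.2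
        · exact Eventually.of_forall fun n _ => by rw [h]; omega
        · exact absurd (Eventually.of_forall fun n => by rw [h]; omega) hb
      · filter_upwards [eventually_ge_atTop c.2.2.natAbs] with n hn _
        have : (c.2.2.natAbs : ℤ) ≤ n := by exact_mod_cast hn
        have h2 : -(c.2.2.natAbs : ℤ) ≤ c.2.2 := by omega
        nlinarith
    have h2 := (C.toFinset.finite_toSet.eventually_all (l := (atTop : Filter ℕ))
      (p := fun c n => c.1 = 0 → 0 ≤ c.2.1 * (n : ℤ) + c.2.2)).2
      (by simpa using key)
    simpa using h2
  let C' := C.filter fun c => c.1 ≠ 0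
  obtain ⟨L, hL⟩ := tendsto_card_homogeneous C'
  refine ⟨L, ?_⟩
  -- Deleting the constant term of a constraint changes its truth only inside this slab, which has
  -- too few points to matter because the normal vector is nonzero for `c ∈ C'`.
  let slab : ((ι → ℤ) × ℤ × ℤ) → ℕ → Finset (ι → ℤ) := fun c n =>
    (box ι n).filter fun x => |∑ i, c.1 i * x i - c.2.1 * n| ≤ |c.2.2|
  let err : ℕ → ℝ := fun n => ∑ c ∈ C'.toFinset, ((slab c n).card : ℝ) / (n : ℝ) ^ Fintype.card ι
  have herr : Tendsto err atTop (𝓝 0) := by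
    rw [← Finset.sum_const_zero (s := C'.toFinset) (ι := (ι → ℤ) × ℤ × ℤ)]
    refine tendsto_finsetSum _ fun c hc => ?_
    have hc0 : c.1 ≠ 0 := by
      simp only [C', List.mem_toFinset, List.mem_filter, decide_eq_true_eq] at hc
      exact hc.2
    obtain ⟨i, hi⟩ := Function.ne_iff.1 hc0
    have hpos : 0 < Fintype.card ι := Fintype.card_pos_iff.2 ⟨i⟩
    have h1 := (tendsto_pow_div_pow (k := Fintype.card ι - 1) (d := Fintype.card ι)
      (by omega)).mul_const ((2 * c.2.2.natAbs + 1 : ℕ) : ℝ)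
    rw [zero_mul] at h1
    refine squeeze_zero (fun n => by positivity) (fun n => ?_) h1
    rw [div_mul_eq_mul_div]
    gcongr
    exact_mod_cast card_slab_le c.1 hc0 c.2.1 c.2.2 n
  refine (hL.congr_dist ?_)
  refine squeeze_zero' (Eventually.of_forall fun n => dist_nonneg) ?_ herr
  filter_upwards [hgood] with n hn
  have hQ' : ∀ x, Q n x ↔ ∀ c ∈ C', ∑ i, c.1 i * x i ≤ c.2.1 * n + c.2.2 := by
    intro x
    rw [hC]
    refine ⟨fun h c hc => h c (List.mem_of_mem_filter hc), fun h c hc => ?_⟩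
    by_cases hc0 : c.1 = 0
    · simpa [hc0] using hn c hc hc0
    · exact h c (List.mem_filter.2 ⟨hc, by simpa using hc0⟩)
  set F := (box ι n).filter fun x => ∀ c ∈ C', ∑ i, c.1 i * x i ≤ c.2.1 * n
  set G := (box ι n).filter fun x => Q n x
  have hsub1 : F ⊆ G ∪ C'.toFinset.biUnion fun c => slab c n := by
    intro x hx
    simp only [F, Finset.mem_filter] at hx
    by_contra hcon
    simp only [G, slab, Finset.mem_union, Finset.mem_filter, Finset.mem_biUnion, hQ', hx.1,
      true_and, List.mem_toFinset, not_or, not_forall, not_exists, not_and] at hcon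
    obtain ⟨⟨c, hc, hc1⟩, h2⟩ := hcon
    refine h2 c hc ?_
    have h3 := hx.2 c hc
    rw [abs_le]
    constructor <;> cases abs_cases c.2.2 <;> omega
  have hsub2 : G ⊆ F ∪ C'.toFinset.biUnion fun c => slab c n := by
    intro x hx
    simp only [G, Finset.mem_filter, hQ'] at hx
    by_contra hcon
    simp only [F, slab, Finset.mem_union, Finset.mem_filter, Finset.mem_biUnion, hx.1,
      true_and, List.mem_toFinset, not_or, not_forall, not_exists, not_and] at hcon
    obtain ⟨⟨c, hc, hc1⟩, h2⟩ := hcon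
    refine h2 c hc ?_
    have h3 := hx.2 c hc
    rw [abs_le]
    constructor <;> cases abs_cases c.2.2 <;> omega
  have hb : ((C'.toFinset.biUnion fun c => slab c n).card : ℝ) ≤
      ∑ c ∈ C'.toFinset, ((slab c n).card : ℝ) := by
    exact_mod_cast Finset.card_biUnion_le
  have h1 : (F.card : ℝ) ≤ G.card + (C'.toFinset.biUnion fun c => slab c n).card := by
    exact_mod_cast (Finset.card_le_card hsub1).trans (Finset.card_union_le _ _)
  have h2 : (G.card : ℝ) ≤ F.card + (C'.toFinset.biUnion fun c => slab c n).card := by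
    exact_mod_cast (Finset.card_le_card hsub2).trans (Finset.card_union_le _ _)
  rw [Real.dist_eq, ← sub_div, abs_div, abs_of_nonneg (by positivity : (0 : ℝ) ≤ (n : ℝ) ^ _)]
  simp only [err, ← Finset.sum_div]
  gcongr
  rw [abs_le]
  constructor <;> linarith

end LatticeCount

/-! ### Normalized moment sums, split by signs and order of absolute values. -/

section PatternSums

variable {ρ : Type*}

/-- The signs of the coordinates of an integer vector and the order of their absolute values. -/
def pattern (v : ρ → ℤ) : (ρ → SignType) × (ρ → ρ → Bool) :=
  (fun q => SignType.sign (v q), fun q q' => decide (|v q| ≤ |v q'|))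

theorem sign_eq_of_pattern_eq {v w : ρ → ℤ} (h : pattern v = pattern w) (q : ρ) :
    SignType.sign (v q) = SignType.sign (w q) :=
  congrFun (congrArg Prod.fst h) q

theorem abs_le_iff_of_pattern_eq {v w : ρ → ℤ} (h : pattern v = pattern w) (q q' : ρ) :
    |v q| ≤ |v q'| ↔ |w q| ≤ |w q'| := by
  simpa [pattern] using congrFun (congrFun (congrArg Prod.snd h) q) q'

theorem abs_eq_iff_of_pattern_eq {v w : ρ → ℤ} (h : pattern v = pattern w) (q q' : ρ) :
    |v q| = |v q'| ↔ |w q| = |w q'| := by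
  rw [le_antisymm_iff, le_antisymm_iff, abs_le_iff_of_pattern_eq h,
    abs_le_iff_of_pattern_eq h]

theorem ne_zero_iff_of_pattern_eq {v w : ρ → ℤ} (h : pattern v = pattern w) (q : ρ) :
    v q ≠ 0 ↔ w q ≠ 0 := by
  rw [← sign_ne_zero (a := v q), sign_eq_of_pattern_eq h, sign_ne_zero]

/-- Once the signs are fixed, absolute values are linear, so a pattern class is cut out by linear
inequalities. This is why patterns record the full order: mere distinctness of absolute values would
not be a convex condition. -/
theorem pattern_eq_iff {v w : ρ → ℤ} (hw : ∀ q, w q ≠ 0) :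
    pattern v = pattern w ↔ (∀ q, 0 < (SignType.sign (w q) : ℤ) * v q) ∧
      ∀ q q', if |w q| ≤ |w q'| then
        (SignType.sign (w q) : ℤ) * v q ≤ (SignType.sign (w q') : ℤ) * v q'
      else (SignType.sign (w q') : ℤ) * v q' < (SignType.sign (w q) : ℤ) * v q := by
  have key : ∀ a b : ℤ, SignType.sign b = SignType.sign a →
      (SignType.sign a : ℤ) * b = |b| := by
    intro a b hab
    rw [← hab, sign_mul_self]
  constructor
  · intro h
    have hv : ∀ q, (SignType.sign (w q) : ℤ) * v q = |v q| := fun q =>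
      key _ _ (sign_eq_of_pattern_eq h q)
    refine ⟨fun q => ?_, fun q q' => ?_⟩
    · rw [hv, abs_pos]
      exact (ne_zero_iff_of_pattern_eq h q).2 (hw q)
    · rw [hv, hv]
      split_ifs with hq
      · exact (abs_le_iff_of_pattern_eq h q q').2 hq
      · exact not_le.1 (mt (abs_le_iff_of_pattern_eq h q q').1 hq)
  · rintro ⟨h1, h2⟩
    have hs : ∀ q, SignType.sign (v q) = SignType.sign (w q) := by
      intro q
      have := h1 q
      rcases lt_or_gt_of_ne (hw q) with h | h
      · rw [sign_neg h] at this ⊢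
        refine sign_neg ?_
        simpa using this
      · rw [sign_pos h] at this ⊢
        refine sign_pos ?_
        simpa using this
    have hv : ∀ q, (SignType.sign (w q) : ℤ) * v q = |v q| := fun q => key _ _ (hs q)
    refine Prod.ext (funext hs) (funext fun q => funext fun q' => ?_)
    have := h2 q q'
    rw [hv, hv] at this
    simp only [pattern, decide_eq_decide]
    split_ifs at this with hq
    · exact iff_of_true this hq
    · exact iff_of_false (not_le.2 this) hq

/-- Every absolute value among the coordinates is attained at least twice. -/
def Partnered (v : ρ → ℤ) : Prop := ∀ q, ∃ q', q' ≠ q ∧ |v q'| = |v q|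

/-- The coordinates do not vanish, and every absolute value among them is attained exactly
twice. -/
def Generic (v : ρ → ℤ) : Prop :=
  (∀ q, v q ≠ 0) ∧ ∀ q, ∃ q', q' ≠ q ∧ ∀ x, |v x| = |v q| ↔ x = q ∨ x = q'

/-- The properties of the joint moments, as functions of the input indices, that govern the
asymptotics of normalized sums of moments. -/
structure IsMomentFunction (E : ℕ → (ρ → ℤ) → ℂ) : Prop where
  bounded : ∃ M : ℝ, ∀ n, 1 ≤ n → ∀ v, ‖E n v‖ ≤ M
  eq_zero : ∀ n, 1 ≤ n → ∀ v, ¬ Partnered v → E n v = 0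
  generic : ∀ n n', 1 ≤ n → 1 ≤ n' → ∀ v v', pattern v = pattern v' → Generic v →
    E n v = E n' v'

/-- A choice of one point in every nonempty fiber of a function. -/
theorem exists_representatives {γ : Type*} (g : ρ → γ) :
    ∃ r : ρ → ρ, (∀ q, g (r q) = g q) ∧ ∀ q q', g q = g q' → r q = r q' := by
  let s : Setoid ρ := Setoid.ker g
  refine ⟨fun q => (Quotient.mk s q).out, fun q => ?_, fun q q' h => ?_⟩
  · exact Quotient.exact (s := s) (Quotient.out_eq (Quotient.mk s q))
  · have : Quotient.mk s q = Quotient.mk s q' := Quotient.sound h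
    simp only [this]

/-- The coordinates that carry the distinct nonzero absolute values. -/
abbrev Reps (v : ρ → ℤ) (r : ρ → ρ) : Type _ := {b : ρ // r b = b ∧ v b ≠ 0}

theorem eq_sign_mul_of_pattern_eq {v₀ v : ρ → ℤ} {r : ρ → ρ} (hr : ∀ q, |v₀ (r q)| = |v₀ q|)
    (h : pattern v = pattern v₀) (q : ρ) :
    v q = (SignType.sign (v₀ q) : ℤ) * (SignType.sign (v₀ (r q)) : ℤ) * v (r q) := by
  have h1 : |v (r q)| = |v q| := (abs_eq_iff_of_pattern_eq h _ _).2 (hr q)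
  rw [mul_assoc, ← sign_eq_of_pattern_eq h (r q), ← sign_eq_of_pattern_eq h q, sign_mul_self,
    h1, sign_mul_abs]

variable [Fintype ρ]

-- A vector in the class is determined by its values at the representatives: zero coordinates are
-- forced, and every other one is a fixed sign times its representative. The extra exponent is for
-- the coordinate `none`, the starting point of the path.
open Classical in
theorem card_pattern_class_le {v₀ : ρ → ℤ} {r : ρ → ρ} (hr : ∀ q, |v₀ (r q)| = |v₀ q|)
    (hr' : ∀ q q', |v₀ q| = |v₀ q'| → r q = r q') (n : ℕ) :
    ((box (Option ρ) n).filter fun x => pattern (fun q => x (some q)) = pattern v₀).card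
      ≤ (2 * n + 1) ^ (Fintype.card (Reps v₀ r) + 1) := by
  rw [← Fintype.card_option, ← card_box]
  refine Finset.card_le_card_of_injOn (fun x o => x (o.map Subtype.val)) ?_ ?_
  · intro x hx
    simp only [Finset.coe_filter, Set.mem_ofPred_eq, mem_box] at hx
    simp only [Finset.mem_coe, mem_box]
    exact fun i => hx.1 _
  · intro x hx y hy hxy
    simp only [Finset.coe_filter, Set.mem_ofPred_eq] at hx hy
    funext o
    rcases o with _ | q
    · exact congrFun hxy none
    · by_cases hq : v₀ q = 0
      · have h1 : x (some q) = 0 :=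
          not_not.1 (mt (ne_zero_iff_of_pattern_eq hx.2 q).1 (not_not.2 hq))
        have h2 : y (some q) = 0 :=
          not_not.1 (mt (ne_zero_iff_of_pattern_eq hy.2 q).1 (not_not.2 hq))
        rw [h1, h2]
      · have hb : v₀ (r q) ≠ 0 := by rw [← abs_ne_zero, hr, abs_ne_zero]; exact hq
        have h3 := congrFun hxy (some ⟨r q, hr' _ _ (hr q), hb⟩)
        simp only [Option.map_some] at h3
        have h1 := eq_sign_mul_of_pattern_eq hr hx.2 q
        have h2 := eq_sign_mul_of_pattern_eq hr hy.2 q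
        rw [h1, h2, h3]

/-- Representatives and their chosen partners are all different, which gives the inequality. In case
of equality they exhaust `ρ`, so no coordinate is zero and no third one shares an absolute value. -/
theorem Partnered.two_mul_card_le {v₀ : ρ → ℤ} (hv : Partnered v₀) {r : ρ → ρ}
    (hr : ∀ q, |v₀ (r q)| = |v₀ q|) (hr' : ∀ q q', |v₀ q| = |v₀ q'| → r q = r q')
    [Fintype (Reps v₀ r)] :
    2 * Fintype.card (Reps v₀ r) ≤ Fintype.card ρ ∧
      (2 * Fintype.card (Reps v₀ r) = Fintype.card ρ → Generic v₀) := by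
  choose p hp hp' using hv
  let g : Reps v₀ r × Bool → ρ := fun b => if b.2 then p b.1 else b.1
  have hrg : ∀ b, r (g b) = b.1 := by
    rintro ⟨⟨b, hb, hb0⟩, _ | _⟩
    · exact hb
    · exact (hr' _ _ (hp' b)).trans hb
  have hg : Function.Injective g := by
    intro b c hbc
    have h1 : b.1 = c.1 := Subtype.ext (by rw [← hrg, ← hrg, hbc])
    refine Prod.ext h1 ?_
    rcases b with ⟨b, _ | _⟩ <;> rcases c with ⟨c, _ | _⟩ <;> simp only [g] at hbc h1 ⊢ <;>
      subst h1
    · exact absurd hbc.symm (hp b)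
    · exact absurd hbc (hp b)
  have hcard : Fintype.card (Reps v₀ r × Bool) = 2 * Fintype.card (Reps v₀ r) := by
    simp [mul_comm]
  refine ⟨hcard ▸ Fintype.card_le_of_injective g hg, fun heq => ?_⟩
  have hbij : Function.Bijective g :=
    (Fintype.bijective_iff_injective_and_card g).2 ⟨hg, hcard.trans heq⟩
  have habs : ∀ b, |v₀ (g b)| = |v₀ b.1| := by
    intro b
    rw [← hr (g b), hrg]
  refine ⟨fun q => ?_, fun q => ?_⟩
  · obtain ⟨b, rfl⟩ := hbij.2 q
    rw [← abs_ne_zero, habs, abs_ne_zero]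
    exact b.1.2.2
  · obtain ⟨⟨b, e⟩, rfl⟩ := hbij.2 q
    refine ⟨g (b, !e), fun h => ?_, fun x => ⟨fun h => ?_, fun h => ?_⟩⟩
    · simpa using congrArg Prod.snd (hg h)
    · obtain ⟨⟨c, e'⟩, rfl⟩ := hbij.2 x
      have hcb : c = b := Subtype.ext (by
        rw [← hrg (c, e'), ← hrg (b, e)]
        exact hr' _ _ h)
      subst hcb
      rcases e with _ | _ <;> rcases e' with _ | _ <;> simp
    · rcases h with rfl | rfl
      · rfl
      · rw [habs, habs]

/-- The lattice vector of a pattern class with prescribed values at the representatives. -/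
def extend (v₀ : ρ → ℤ) (r : ρ → ρ) (hr : ∀ q, r (r q) = r q ∧ v₀ (r q) ≠ 0)
    (y : Option (Reps v₀ r) → ℤ) : Option ρ → ℤ
  | none => y none
  | some q => (SignType.sign (v₀ q) : ℤ) * (SignType.sign (v₀ (r q)) : ℤ) * y (some ⟨r q, hr q⟩)

-- When no coordinate vanishes, restriction to the representatives and `extend` are inverse
-- bijections; signs have modulus one, so the cube is preserved. The count thus becomes one in the
-- correct dimension.
open Classical in
theorem card_pattern_class_eq {v₀ : ρ → ℤ} {r : ρ → ρ} (hr : ∀ q, |v₀ (r q)| = |v₀ q|)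
    (hr' : ∀ q, r (r q) = r q ∧ v₀ (r q) ≠ 0) (hv₀ : ∀ q, v₀ q ≠ 0) (n : ℕ)
    (S : (Option ρ → ℤ) → Prop) :
    ((box (Option ρ) n).filter fun x => S x ∧ pattern (fun q => x (some q)) = pattern v₀).card =
    ((box (Option (Reps v₀ r)) n).filter fun y => S (extend v₀ r hr' y) ∧
      pattern (fun q => extend v₀ r hr' y (some q)) = pattern v₀).card := by
  let res : (Option ρ → ℤ) → Option (Reps v₀ r) → ℤ := fun x o => x (o.map Subtype.val)
  have h1 : ∀ x, pattern (fun q => x (some q)) = pattern v₀ → extend v₀ r hr' (res x) = x := by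
    intro x hx
    funext o
    rcases o with _ | q
    · rfl
    · exact (eq_sign_mul_of_pattern_eq hr hx q).symm
  have hss : ∀ q q',
      |(SignType.sign (v₀ q) : ℤ) * (SignType.sign (v₀ q') : ℤ)| = 1 := by
    intro q q'
    rcases lt_or_gt_of_ne (hv₀ q) with h | h <;> rcases lt_or_gt_of_ne (hv₀ q') with h' | h' <;>
      simp [sign_neg, sign_pos, h, h']
  have h2 : ∀ y, res (extend v₀ r hr' y) = y := by
    intro y
    funext o
    rcases o with _ | ⟨b, hb, hb0⟩
    · rfl
    · have : (SignType.sign (v₀ b) : ℤ) * (SignType.sign (v₀ b) : ℤ) = 1 := by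
        rcases lt_or_gt_of_ne hb0 with h | h <;> simp [sign_neg, sign_pos, h]
      simp only [res, extend, Option.map_some, hb, this, one_mul]
  refine Finset.card_nbij' res (extend v₀ r hr') ?_ ?_ ?_ ?_
  · intro x hx
    simp only [Finset.coe_filter, Set.mem_ofPred_eq, mem_box] at hx ⊢
    rw [h1 x hx.2.2]
    exact ⟨fun i => hx.1 _, hx.2⟩
  · intro y hy
    simp only [Finset.coe_filter, Set.mem_ofPred_eq, mem_box] at hy ⊢
    refine ⟨fun o => ?_, hy.2⟩
    rcases o with _ | q
    · exact hy.1 none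
    · rw [← abs_le]
      simp only [extend]
      rw [abs_mul, hss, one_mul]
      exact abs_le.2 (hy.1 _)
  · intro x hx
    simp only [Finset.coe_filter, Set.mem_ofPred_eq] at hx
    exact h1 x hx.2.2
  · intro y _
    exact h2 y

theorem isPoly_pattern_class {v₀ : ρ → ℤ} {r : ρ → ρ} [Fintype (Reps v₀ r)]
    (hr' : ∀ q, r (r q) = r q ∧ v₀ (r q) ≠ 0) (hv₀ : ∀ q, v₀ q ≠ 0)
    {Q : ℕ → (Option ρ → ℤ) → Prop} (hQ : IsPoly Q) :
    IsPoly fun n y => Q n (extend v₀ r hr' y) ∧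
      pattern (fun q => extend v₀ r hr' y (some q)) = pattern v₀ := by
  have hext : ∀ o, IsAffine fun (_ : ℕ) y => extend v₀ r hr' y o := by
    intro o
    rcases o with _ | q
    · exact IsAffine.coord none
    · exact (IsAffine.coord _).const_mul _
  refine (hQ.comp hext).and ?_
  simp only [pattern_eq_iff hv₀]
  refine (IsPoly.forall fun q => IsPoly.lt (IsAffine.const 0) ((hext _).const_mul _)).and
    (IsPoly.forall fun q => IsPoly.forall fun q' => ?_)
  split_ifs
  · exact IsPoly.le ((hext _).const_mul _) ((hext _).const_mul _)
  · exact IsPoly.lt ((hext _).const_mul _) ((hext _).const_mul _)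

/-- The normalization of moment sums with `k` random factors. -/
def normFactor (k n : ℕ) : ℂ := (n : ℂ)⁻¹ * (((Real.sqrt n : ℝ) : ℂ)⁻¹) ^ k

theorem norm_normFactor (k n : ℕ) : ‖normFactor k n‖ = ((n : ℝ) * Real.sqrt n ^ k)⁻¹ := by
  simp [normFactor, abs_of_nonneg, Real.sqrt_nonneg, mul_comm]

open Classical in
theorem norm_class_sum_le {E : ℕ → (ρ → ℤ) → ℂ} {M : ℝ}
    (hM : ∀ n, 1 ≤ n → ∀ v, ‖E n v‖ ≤ M) {v₀ : ρ → ℤ} {r : ρ → ρ}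
    (hr : ∀ q, |v₀ (r q)| = |v₀ q|) (hr' : ∀ q q', |v₀ q| = |v₀ q'| → r q = r q')
    {n : ℕ} (hn : 1 ≤ n) (S : (Option ρ → ℤ) → Prop) :
    ‖normFactor (Fintype.card ρ) n * ∑ x ∈ (box (Option ρ) n).filter fun x =>
      S x ∧ pattern (fun q => x (some q)) = pattern v₀, E n (fun q => x (some q))‖ ≤
      ((2 * n + 1 : ℕ) : ℝ) ^ (Fintype.card (Reps v₀ r) + 1) /
        ((n : ℝ) * Real.sqrt n ^ Fintype.card ρ) * M := by
  have hM0 : 0 ≤ M := (norm_nonneg _).trans (hM n hn 0)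
  rw [norm_mul, norm_normFactor, inv_mul_eq_div, div_mul_eq_mul_div]
  gcongr
  refine (norm_sum_le_of_le _ fun x _ => hM n hn _).trans ?_
  rw [Finset.sum_const, nsmul_eq_mul]
  gcongr
  refine le_trans ?_ (Nat.cast_le.2 (card_pattern_class_le hr hr' n)) |>.trans_eq (by push_cast; rfl)
  refine Nat.cast_le.2 (Finset.card_le_card fun x hx => ?_)
  rw [Finset.mem_filter] at hx ⊢
  exact ⟨hx.1, hx.2.2⟩

-- The number of terms is at most of the order of the normalization for every partnered pattern, and
-- the moments vanish for the others. The constant is independent of `S`.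
open Classical in
theorem norm_pattern_sum_le {E : ℕ → (ρ → ℤ) → ℂ} (hE : IsMomentFunction E)
    (τ : (ρ → SignType) × (ρ → ρ → Bool)) :
    ∃ K : ℝ, ∀ n, 1 ≤ n → ∀ S : (Option ρ → ℤ) → Prop,
    ‖normFactor (Fintype.card ρ) n * ∑ x ∈ (box (Option ρ) n).filter fun x =>
      S x ∧ pattern (fun q => x (some q)) = τ, E n (fun q => x (some q))‖ ≤ K := by
  by_cases hτ : ∃ v₀ : ρ → ℤ, pattern v₀ = τ ∧ Partnered v₀
  · obtain ⟨v₀, rfl, hp⟩ := hτ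
    obtain ⟨r, hr, hr'⟩ := exists_representatives fun q => |v₀ q|
    obtain ⟨M, hM⟩ := hE.bounded
    have hM0 : 0 ≤ M := (norm_nonneg _).trans (hM 1 le_rfl 0)
    have hk := (hp.two_mul_card_le hr hr').1
    set k := Fintype.card (Reps v₀ r)
    -- The factor `3` comes from `2 n + 1 ≤ 3 n` for `n ≥ 1`.
    refine ⟨3 ^ (k + 1) * M, fun n hn S => (norm_class_sum_le hM hr hr' hn S).trans ?_⟩
    have hn' : (1 : ℝ) ≤ n := by exact_mod_cast hn
    have hs : (1 : ℝ) ≤ Real.sqrt n := Real.one_le_sqrt.2 hn'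
    gcongr
    rw [div_le_iff₀ (by positivity)]
    have h1 : (n : ℝ) ^ k ≤ Real.sqrt n ^ Fintype.card ρ := by
      calc (n : ℝ) ^ k = Real.sqrt n ^ (2 * k) := by
            rw [pow_mul, Real.sq_sqrt (by positivity)]
        _ ≤ _ := pow_le_pow_right₀ hs hk
    calc ((2 * n + 1 : ℕ) : ℝ) ^ (k + 1) ≤ (3 * n) ^ (k + 1) := by
          gcongr; push_cast; linarith
      _ = 3 ^ (k + 1) * (n * n ^ k) := by rw [mul_pow]; ring
      _ ≤ _ := by gcongr
  · refine ⟨0, fun n hn S => le_of_eq ?_⟩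
    rw [Finset.sum_eq_zero, mul_zero, norm_zero]
    intro x hx
    refine hE.eq_zero n hn _ fun hp => hτ ⟨_, (Finset.mem_filter.1 hx).2.2, hp⟩

-- Three cases: no partnered vector, where all terms vanish; fewer than half as many representatives
-- as coordinates, where the terms are too few; exactly half, where the pattern is generic, the
-- moment is constant and the lattice count converges.
open Classical in
theorem tendsto_pattern_sum {E : ℕ → (ρ → ℤ) → ℂ} (hE : IsMomentFunction E)
    {Q : ℕ → (Option ρ → ℤ) → Prop} (hQ : IsPoly Q) (τ : (ρ → SignType) × (ρ → ρ → Bool)) :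
    ∃ L : ℂ, Tendsto (fun n : ℕ => normFactor (Fintype.card ρ) n *
      ∑ x ∈ (box (Option ρ) n).filter fun x => Q n x ∧ pattern (fun q => x (some q)) = τ,
        E n (fun q => x (some q))) atTop (𝓝 L) := by
  by_cases hτ : ∃ v₀ : ρ → ℤ, pattern v₀ = τ ∧ Partnered v₀
  swap
  · refine ⟨0, tendsto_const_nhds.congr' ?_⟩
    filter_upwards [eventually_ge_atTop 1] with n hn
    rw [Finset.sum_eq_zero, mul_zero]
    intro x hx
    exact hE.eq_zero n hn _ fun hp => hτ ⟨_, (Finset.mem_filter.1 hx).2.2, hp⟩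
  obtain ⟨v₀, rfl, hp⟩ := hτ
  obtain ⟨r, hr, hr'⟩ := exists_representatives fun q => |v₀ q|
  obtain ⟨M, hM⟩ := hE.bounded
  obtain ⟨hk, hgen⟩ := hp.two_mul_card_le hr hr'
  rcases hk.lt_or_eq with hk | hk
  · refine ⟨0, ?_⟩
    -- The normalization may be a half-integer power of `n`, so the bound is treated as the square
    -- root of a ratio of integer powers.
    have h1 := (tendsto_pow_div_pow (k := 2 * Fintype.card (Reps v₀ r) + 2)
      (d := Fintype.card ρ + 2) (by omega)).sqrt.mul_const M
    rw [Real.sqrt_zero, zero_mul] at h1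
    refine squeeze_zero_norm' ?_ h1
    filter_upwards [eventually_ge_atTop 1] with n hn
    refine (norm_class_sum_le hM hr hr' hn _).trans_eq ?_
    congr 1
    rw [Real.sqrt_div (by positivity), pow_add (n : ℝ),
      Real.sqrt_mul (by positivity), Real.sqrt_sq (by positivity),
      show 2 * Fintype.card (Reps v₀ r) + 2 = (Fintype.card (Reps v₀ r) + 1) * 2 by ring,
      pow_mul, Real.sqrt_sq (by positivity), mul_comm (Real.sqrt _)]
    congr 2
    rw [← Real.sqrt_sq (by positivity : (0 : ℝ) ≤ Real.sqrt n ^ Fintype.card ρ), ← pow_mul,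
      mul_comm _ 2, pow_mul, Real.sq_sqrt (by positivity)]
  · have hg := hgen hk
    have hrr : ∀ q, r (r q) = r q ∧ v₀ (r q) ≠ 0 := fun q => ⟨hr' _ _ (hr q), hg.1 _⟩
    obtain ⟨L, hL⟩ := (isPoly_pattern_class hrr hg.1 hQ).tendsto_card
    refine ⟨L * E 1 v₀, ?_⟩
    have h1 := ((Complex.continuous_ofReal.tendsto L).comp hL).mul_const (E 1 v₀)
    refine h1.congr' ?_
    filter_upwards [eventually_ge_atTop 1] with n hn
    have hsum : ∑ x ∈ (box (Option ρ) n).filter fun x =>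
        Q n x ∧ pattern (fun q => x (some q)) = pattern v₀, E n (fun q => x (some q)) =
        ∑ x ∈ (box (Option ρ) n).filter fun x =>
        Q n x ∧ pattern (fun q => x (some q)) = pattern v₀, E 1 v₀ :=
      Finset.sum_congr rfl fun x hx =>
        (hE.generic 1 n le_rfl hn _ _ (Finset.mem_filter.1 hx).2.2.symm hg).symm
    rw [hsum, Finset.sum_const, nsmul_eq_mul, card_pattern_class_eq hr hrr hg.1 n (Q n),
      ← mul_assoc]
    congr 1
    simp only [Function.comp_apply, normFactor]
    rw [← hk, pow_mul, inv_pow, ← Complex.ofReal_pow, Real.sq_sqrt (by positivity),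
      Fintype.card_option]
    push_cast
    rw [inv_pow, pow_succ, div_eq_mul_inv, mul_inv, mul_comm (_ * _) (Nat.cast _),
      mul_comm (_ ^ _)⁻¹]
    congr!

open Classical in
/-- The normalized sum of moments over the lattice points of `S` in the cube. -/
def momentSum (E : ℕ → (ρ → ℤ) → ℂ) (n : ℕ) (S : (Option ρ → ℤ) → Prop) : ℂ :=
  normFactor (Fintype.card ρ) n *
    ∑ x ∈ (box (Option ρ) n).filter fun x => S x, E n (fun q => x (some q))

open Classical in
theorem momentSum_eq_sum_pattern (E : ℕ → (ρ → ℤ) → ℂ) (n : ℕ) (S : (Option ρ → ℤ) → Prop) :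
    momentSum E n S = ∑ τ : (ρ → SignType) × (ρ → ρ → Bool), normFactor (Fintype.card ρ) n *
      ∑ x ∈ (box (Option ρ) n).filter fun x => S x ∧ pattern (fun q => x (some q)) = τ,
        E n (fun q => x (some q)) := by
  rw [momentSum, ← Finset.mul_sum]
  congr 1
  rw [← Finset.sum_fiberwise _ fun x : Option ρ → ℤ => pattern fun q => x (some q)]
  exact Finset.sum_congr rfl fun τ _ => by rw [Finset.filter_filter]

/-- Uniformity in `S` is what dominated convergence requires later, where every choice of
deterministic indices imposes its own constraint. -/
theorem IsMomentFunction.exists_bound {E : ℕ → (ρ → ℤ) → ℂ} (hE : IsMomentFunction E) :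
    ∃ K : ℝ, ∀ n, 1 ≤ n → ∀ S, ‖momentSum E n S‖ ≤ K := by
  classical
  choose K hK using norm_pattern_sum_le hE
  refine ⟨∑ τ, K τ, fun n hn S => ?_⟩
  rw [momentSum_eq_sum_pattern]
  exact norm_sum_le_of_le _ fun τ _ => hK τ n hn S

theorem IsMomentFunction.tendsto_momentSum {E : ℕ → (ρ → ℤ) → ℂ} (hE : IsMomentFunction E)
    {Q : ℕ → (Option ρ → ℤ) → Prop} (hQ : IsPoly Q) :
    ∃ L : ℂ, Tendsto (fun n => momentSum E n (Q n)) atTop (𝓝 L) := by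
  classical
  choose L hL using tendsto_pattern_sum hE hQ
  refine ⟨∑ τ, L τ, ?_⟩
  simp only [momentSum_eq_sum_pattern]
  exact tendsto_finsetSum _ fun τ _ => hL τ

end PatternSums

/-! ### Traces of products of Toeplitz matrices as sums over closed paths. -/

section Matrices

open Matrix

theorem backwardIdentity_apply {n : ℕ} (i j : Fin n) :
    backwardIdentity n i j = if j = Fin.rev i then 1 else 0 := by
  simp only [backwardIdentity, Matrix.of_apply, Fin.ext_iff, Fin.val_rev]
  congr 1
  rw [eq_iff_iff]
  omega

theorem backwardIdentity_mul_apply {n : ℕ} (M : Matrix (Fin n) (Fin n) ℂ) (i j : Fin n) :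
    (backwardIdentity n * M) i j = M (Fin.rev i) j := by
  simp [Matrix.mul_apply, backwardIdentity_apply]

theorem mul_backwardIdentity_apply {n : ℕ} (M : Matrix (Fin n) (Fin n) ℂ) (i j : Fin n) :
    (M * backwardIdentity n) i j = M i (Fin.rev j) := by
  have h : ∀ x : Fin n, (j = Fin.rev x) ↔ x = Fin.rev j := fun x =>
    ⟨fun h => by rw [h, Fin.rev_rev], fun h => by rw [h, Fin.rev_rev]⟩
  simp [Matrix.mul_apply, backwardIdentity_apply, h]

theorem backwardIdentity_mul_self (n : ℕ) : backwardIdentity n * backwardIdentity n = 1 := by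
  ext i j
  rw [backwardIdentity_mul_apply, backwardIdentity_apply, Fin.rev_rev, Matrix.one_apply]
  simp only [eq_comm]

theorem star_backwardIdentity (n : ℕ) : star (backwardIdentity n) = backwardIdentity n := by
  ext i j
  rw [Matrix.star_apply]
  simp only [backwardIdentity, Matrix.of_apply, add_comm (j : ℕ)]
  split_ifs <;> simp

theorem backwardIdentity_mul_toeplitz (c : ℤ → ℂ) (n : ℕ) :
    backwardIdentity n * toeplitz c n = toeplitz (fun v => c (-v)) n * backwardIdentity n := by
  ext i j
  rw [backwardIdentity_mul_apply, mul_backwardIdentity_apply]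
  simp only [toeplitz, Matrix.of_apply, Fin.val_rev]
  congr 1
  omega

theorem star_toeplitz (c : ℤ → ℂ) (n : ℕ) :
    star (toeplitz c n) = toeplitz (fun v => star (c (-v))) n := by
  ext i j
  rw [Matrix.star_apply]
  simp only [toeplitz, Matrix.of_apply, neg_sub]

/-- The Toeplitz matrix with ones on the diagonal of index `v` and zeros elsewhere. -/
def shift (n : ℕ) (v : ℤ) : Matrix (Fin n) (Fin n) ℂ := toeplitz (Pi.single v 1) n

theorem toeplitz_eq_sum_shift (c : ℤ → ℂ) (n : ℕ) :
    toeplitz c n = ∑ v ∈ Finset.Icc (-(n : ℤ)) n, c v • shift n v := by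
  ext i j
  have h : ((i : ℕ) : ℤ) - (j : ℕ) ∈ Finset.Icc (-(n : ℤ)) n := by
    rw [Finset.mem_Icc]; omega
  simp only [Matrix.sum_apply, Matrix.smul_apply, shift, toeplitz, Matrix.of_apply,
    Pi.single_apply, smul_eq_mul, mul_ite, mul_one, mul_zero]
  rw [Finset.sum_ite_eq, if_pos h]

theorem prod_toeplitz_eq_sum {k : ℕ} (c : Fin k → ℤ → ℂ) (n : ℕ) :
    (List.ofFn fun p => toeplitz (c p) n).prod =
      ∑ v ∈ box (Fin k) n, (∏ p, c p (v p)) • (List.ofFn fun p => shift n (v p)).prod := by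
  classical
  simp only [toeplitz_eq_sum_shift]
  have h := (MultilinearMap.mkPiAlgebraFin ℂ k (Matrix (Fin n) (Fin n) ℂ)).map_sum_finset
    (fun p v => c p v • shift n v) (fun _ => Finset.Icc (-(n : ℤ)) n)
  simp only [MultilinearMap.mkPiAlgebraFin_apply] at h
  rw [h]
  refine Finset.sum_congr (by rw [box]; congr!) fun v _ => ?_
  have h2 := (MultilinearMap.mkPiAlgebraFin ℂ k (Matrix (Fin n) (Fin n) ℂ)).map_smul_univ
    (fun p => c p (v p)) (fun p => shift n (v p))
  simpa only [MultilinearMap.mkPiAlgebraFin_apply] using h2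

/-- The path that starts at `i` and takes the steps `-v`, `v ∈ l`, stays in `[0, n)`. -/
def InRange (n : ℕ) : List ℤ → ℤ → Prop
  | [], i => 0 ≤ i ∧ i < n
  | v :: l, i => (0 ≤ i ∧ i < n) ∧ InRange n l (i - v)

theorem InRange.mem {n : ℕ} {l : List ℤ} {i : ℤ} (h : InRange n l i) : 0 ≤ i ∧ i < n := by
  cases l with
  | nil => exact h
  | cons v l => exact h.1

-- A row of a shift has at most one nonzero entry, so a row of the product follows a single path and
-- vanishes once the path leaves `[0, n)`.
open Classical in
theorem prod_shift_apply {n : ℕ} (l : List ℤ) (i j : Fin n) :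
    (l.map (shift n)).prod i j =
      if InRange n l ((i : ℕ) : ℤ) ∧ ((i : ℕ) : ℤ) - l.sum = ((j : ℕ) : ℤ) then 1 else 0 := by
  induction l generalizing i with
  | nil =>
    have h : InRange n [] ((i : ℕ) : ℤ) := ⟨by omega, by omega⟩
    simp [h, Matrix.one_apply, Fin.ext_iff]
  | cons v l ih =>
    rw [List.map_cons, List.prod_cons, Matrix.mul_apply]
    simp only [ih]
    by_cases hv : 0 ≤ ((i : ℕ) : ℤ) - v ∧ ((i : ℕ) : ℤ) - v < n
    · have hx : ∀ x : Fin n, shift n v i x =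
          if x = ⟨(((i : ℕ) : ℤ) - v).toNat, by omega⟩ then 1 else 0 := by
        intro x
        simp only [shift, toeplitz, Matrix.of_apply, Pi.single_apply, Fin.ext_iff]
        congr 1
        rw [eq_iff_iff]
        omega
      have e : ((((i : ℕ) : ℤ) - v).toNat : ℤ) = ((i : ℕ) : ℤ) - v := Int.toNat_of_nonneg hv.1
      simp only [hx, ite_mul, one_mul, zero_mul, Finset.sum_ite_eq', Finset.mem_univ, if_true, e,
        InRange, List.sum_cons, sub_sub]
      congr 1
      rw [eq_iff_iff]
      constructor
      · rintro ⟨h1, h2⟩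
        exact ⟨⟨⟨by omega, by omega⟩, h1⟩, h2⟩
      · rintro ⟨⟨-, h1⟩, h2⟩
        exact ⟨h1, h2⟩
    · rw [if_neg fun h => hv h.1.2.mem]
      refine Finset.sum_eq_zero fun x _ => ?_
      rw [shift, toeplitz, Matrix.of_apply, Pi.single_apply, if_neg, zero_mul]
      omega

/-- The path with steps `-v`, `v ∈ l`, that starts at `i` stays in `[0, n)` and ends at `i`, or at
the mirror image of `i` if `δ` is set. -/
def IsClosedPath (n : ℕ) (δ : Bool) (l : List ℤ) (i : ℤ) : Prop :=
  InRange n l i ∧ i - l.sum = if δ then (n : ℤ) - 1 - i else i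

/-- The power of the backward identity with exponent zero or one. -/
def backwardPow (δ : Bool) (n : ℕ) : Matrix (Fin n) (Fin n) ℂ :=
  if δ then backwardIdentity n else 1

-- Starting points range over `[-n, n]` so that they can serve as one more coordinate of the cube;
-- those outside `[0, n)` contribute nothing.
open Classical in
theorem trace_prod_shift {n : ℕ} (δ : Bool) (l : List ℤ) :
    ((l.map (shift n)).prod * backwardPow δ n).trace =
      ∑ i ∈ Finset.Icc (-(n : ℤ)) n, if IsClosedPath n δ l i then 1 else 0 := by
  have h1 : ((l.map (shift n)).prod * backwardPow δ n).trace =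
      ∑ i : Fin n, if IsClosedPath n δ l ((i : ℕ) : ℤ) then 1 else 0 := by
    refine Finset.sum_congr rfl fun i _ => ?_
    cases δ
    · simp only [backwardPow, Bool.false_eq_true, if_false, mul_one, Matrix.diag_apply,
        prod_shift_apply, IsClosedPath]
    · simp only [backwardPow, if_true, Matrix.diag_apply, mul_backwardIdentity_apply,
        prod_shift_apply, IsClosedPath, Fin.val_rev]
      congr 1
      rw [eq_iff_iff]
      refine and_congr_right fun _ => ?_
      omega
  rw [h1, ← Finset.sum_subset (s₁ := Finset.Ico (0 : ℤ) n)]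
  · rw [Finset.sum_fin_eq_sum_range]
    refine Finset.sum_bij (fun (k : ℕ) _ => (k : ℤ)) ?_ ?_ ?_ ?_
    · intro k hk
      simp only [Finset.mem_range] at hk
      simp only [Finset.mem_Ico]
      omega
    · intro a _ b _ h
      exact_mod_cast h
    · intro b hb
      simp only [Finset.mem_Ico] at hb
      exact ⟨b.toNat, by simp only [Finset.mem_range]; omega, by omega⟩
    · intro k hk
      rw [dif_pos (Finset.mem_range.1 hk)]
  · intro x hx
    simp only [Finset.mem_Ico, Finset.mem_Icc] at hx ⊢
    omega
  · intro x _ hx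
    rw [if_neg]
    intro h
    exact hx (Finset.mem_Ico.2 h.1.mem)

open Classical in
theorem trace_prod_toeplitz {k : ℕ} (c : Fin k → ℤ → ℂ) (δ : Bool) (n : ℕ) :
    ((List.ofFn fun p => toeplitz (c p) n).prod * backwardPow δ n).trace =
      ∑ v ∈ box (Fin k) n, (∏ p, c p (v p)) *
        ∑ i ∈ Finset.Icc (-(n : ℤ)) n, if IsClosedPath n δ (List.ofFn v) i then 1 else 0 := by
  rw [prod_toeplitz_eq_sum, Finset.sum_mul, Matrix.trace_sum]
  refine Finset.sum_congr rfl fun v _ => ?_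
  rw [← trace_prod_shift, List.map_ofFn, Matrix.smul_mul, Matrix.trace_smul, smul_eq_mul]
  rfl

theorem isPoly_inRange {ι : Type*} [Fintype ι] (l : List (ℕ → (ι → ℤ) → ℤ))
    (hl : ∀ g ∈ l, IsAffine g) {f : ℕ → (ι → ℤ) → ℤ} (hf : IsAffine f) :
    IsPoly fun n x => InRange n (l.map fun g => g n x) (f n x) := by
  have h0 : IsPoly fun n x => 0 ≤ f n x ∧ f n x < (n : ℤ) :=
    (IsPoly.le (IsAffine.const 0) hf).and (IsPoly.lt hf IsAffine.scale)
  induction l generalizing f with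
  | nil => exact h0
  | cons g l ih =>
    have hg := hf.sub (hl g List.mem_cons_self)
    exact h0.and (ih (fun g hg => hl g (List.mem_cons_of_mem _ hg)) hg
      ((IsPoly.le (IsAffine.const 0) hg).and (IsPoly.lt hg IsAffine.scale)))

/-- Every vertex of the path is affine in the steps and the start, and so is the prescribed end
point, mirrored or not. This reduces the trace to lattice counting. -/
theorem isPoly_isClosedPath {ι : Type*} [Fintype ι] {k : ℕ} (δ : Bool)
    {g : Fin k → ℕ → (ι → ℤ) → ℤ} (hg : ∀ p, IsAffine (g p)) {f : ℕ → (ι → ℤ) → ℤ}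
    (hf : IsAffine f) :
    IsPoly fun n x => IsClosedPath n δ (List.ofFn fun p => g p n x) (f n x) := by
  have h1 := isPoly_inRange (List.ofFn g) (by simpa [List.mem_ofFn] using hg) hf
  simp only [List.map_ofFn, Function.comp_def] at h1
  refine h1.and ?_
  simp only [List.sum_ofFn]
  refine IsPoly.eq (hf.sub (IsAffine.sum _ hg)) ?_
  cases δ
  · simpa using hf
  · simpa using (IsAffine.scale.sub (IsAffine.const 1)).sub hf

end Matrices

/-! ### Rewriting words as Toeplitz products with at most one backward identity. -/

section NormalForm

variable {Ω : Type*} {r : ℕ}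

/-- The inputs of the Toeplitz factors of a normal form: a scaled random input, possibly reflected
and conjugated, or a deterministic sequence. -/
inductive Letter (r : ℕ) : Type
  | rand (k : Fin r) (refl conj : Bool)
  | det (c : ℤ → ℂ)

/-- The random variable of index `v` of an input that is possibly reflected and conjugated. -/
def entry (u : Fin r → ℕ → ℤ → Ω → ℂ) (k : Fin r) (refl conj : Bool) (n : ℕ) (v : ℤ) (ω : Ω) : ℂ :=
  if conj then star (u k n (if refl then -v else v) ω) else u k n (if refl then -v else v) ω

/-- The input sequence of a letter. -/
def Letter.coef (u : Fin r → ℕ → ℤ → Ω → ℂ) (n : ℕ) (ω : Ω) : Letter r → ℤ → ℂ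
  | .rand k s c, v => ((Real.sqrt n : ℝ) : ℂ)⁻¹ * entry u k s c n v ω
  | .det d, v => d v

/-- The deterministic letters have summable inputs. -/
def Letter.IsSummable : Letter r → Prop
  | .rand _ _ _ => True
  | .det d => Summable fun v => ‖d v‖

/-- The letter with the reflected input. -/
def Letter.reflect : Letter r → Letter r
  | .rand k s c => .rand k (!s) c
  | .det d => .det fun v => d (-v)

theorem Letter.coef_reflect (u : Fin r → ℕ → ℤ → Ω → ℂ) (n : ℕ) (ω : Ω) (l : Letter r) :
    l.reflect.coef u n ω = fun v => l.coef u n ω (-v) := by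
  funext v
  rcases l with ⟨k, s, c⟩ | d
  · cases s <;> simp [Letter.reflect, Letter.coef, entry]
  · rfl

theorem Letter.IsSummable.reflect {l : Letter r} (hl : l.IsSummable) : l.reflect.IsSummable := by
  rcases l with ⟨k, s, c⟩ | d
  · trivial
  · exact (Equiv.neg ℤ).summable_iff.2 hl

/-- A family of random matrices that is a product of Toeplitz matrices with letters as inputs,
possibly followed by the backward identity. -/
def HasNormalForm (u : Fin r → ℕ → ℤ → Ω → ℂ) (A : (n : ℕ) → Ω → Matrix (Fin n) (Fin n) ℂ) :
    Prop :=
  ∃ (ls : List (Letter r)) (δ : Bool), (∀ l ∈ ls, l.IsSummable) ∧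
    ∀ n ω, A n ω = (ls.map fun l => toeplitz (l.coef u n ω) n).prod * backwardPow δ n

variable {u : Fin r → ℕ → ℤ → Ω → ℂ}

theorem backwardPow_mul_prod (ls : List (Letter r)) (δ : Bool) (n : ℕ) (ω : Ω) :
    backwardPow δ n * (ls.map fun l => toeplitz (l.coef u n ω) n).prod =
      ((ls.map fun l => if δ then l.reflect else l).map
        fun l => toeplitz (l.coef u n ω) n).prod * backwardPow δ n := by
  cases δ
  · simp [backwardPow]
  · induction ls with
    | nil => simp
    | cons l ls ih =>
      simp only [if_true, backwardPow, List.map_cons, List.prod_cons] at ih ⊢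
      rw [← mul_assoc, backwardIdentity_mul_toeplitz, mul_assoc, ih, Letter.coef_reflect,
        mul_assoc]

theorem HasNormalForm.mul {A B : (n : ℕ) → Ω → Matrix (Fin n) (Fin n) ℂ}
    (hA : HasNormalForm u A) (hB : HasNormalForm u B) :
    HasNormalForm u fun n ω => A n ω * B n ω := by
  obtain ⟨ls, δ, hls, hA⟩ := hA
  obtain ⟨ls', δ', hls', hB⟩ := hB
  -- The power that ends the first product moves through the second, reflecting its letters when it
  -- is `P`; the two powers then merge because `P² = 1`.
  refine ⟨ls ++ ls'.map (fun l => if δ then l.reflect else l), xor δ δ', ?_, fun n ω => ?_⟩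
  · intro l hl
    rcases List.mem_append.1 hl with hl | hl
    · exact hls l hl
    · obtain ⟨l', hl', rfl⟩ := List.mem_map.1 hl
      split_ifs
      · exact (hls' l' hl').reflect
      · exact hls' l' hl'
  · have hpow : backwardPow (xor δ δ') n = backwardPow δ n * backwardPow δ' n := by
      cases δ <;> cases δ' <;> simp [backwardPow, backwardIdentity_mul_self]
    change A n ω * B n ω = _
    rw [hA, hB, List.map_append, List.prod_append, hpow, ← mul_assoc,
      mul_assoc (List.prod _) (backwardPow δ n), backwardPow_mul_prod]
    simp only [mul_assoc]

theorem HasNormalForm.one : HasNormalForm u fun _ _ => 1 :=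
  ⟨[], false, by simp, fun n ω => by simp [backwardPow]⟩

theorem HasNormalForm.backward : HasNormalForm u fun n _ => backwardIdentity n :=
  ⟨[], true, by simp, fun n ω => by simp [backwardPow]⟩

theorem HasNormalForm.letter {l : Letter r} (hl : l.IsSummable) :
    HasNormalForm u fun n ω => toeplitz (l.coef u n ω) n :=
  ⟨[l], false, by simpa using hl, fun n ω => by simp [backwardPow]⟩

theorem HasNormalForm.congr {A B : (n : ℕ) → Ω → Matrix (Fin n) (Fin n) ℂ}
    (hA : HasNormalForm u A) (h : ∀ n ω, B n ω = A n ω) : HasNormalForm u B := by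
  obtain ⟨ls, δ, hls, hA⟩ := hA
  exact ⟨ls, δ, hls, fun n ω => (h n ω).trans (hA n ω)⟩

theorem smul_toeplitz (a : ℂ) (c : ℤ → ℂ) (n : ℕ) :
    a • toeplitz c n = toeplitz (fun v => a * c v) n := by
  ext i j
  simp [toeplitz]

/-- The adjoint of a Toeplitz matrix has the reflected and conjugated input, and `(P T)* = T* P`, so
letters with flags for reflection and conjugation are closed under all operations needed. -/
theorem hasNormalForm_collection {m : ℕ} (t h : Fin m → Fin r) (d e : Fin m → ℤ → ℂ)
    (hd : ∀ i, Summable fun k => ‖d i k‖) (he : ∀ i, Summable fun k => ‖e i k‖) (l : Label m)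
    (b : Bool) :
    HasNormalForm u fun n ω =>
      if b then star (collection (fun i => u (t i)) (fun i => u (h i)) d e l n ω)
      else collection (fun i => u (t i)) (fun i => u (h i)) d e l n ω := by
  have hadj : ∀ c : ℤ → ℂ, (Summable fun v => ‖c v‖) →
      (Letter.det (r := r) fun v => star (c (-v))).IsSummable := by
    intro c hc
    change Summable fun v => ‖star (c (-v))‖
    simp only [norm_star]
    exact (Equiv.neg ℤ).summable_iff.2 hc
  have hrs : ∀ (k : Fin r) (n : ℕ) (ω : Ω),
      star (((Real.sqrt n : ℝ) : ℂ)⁻¹ • toeplitz (fun j => u k n j ω) n) =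
        toeplitz ((Letter.rand k true true).coef u n ω) n := by
    intro k n ω
    rw [smul_toeplitz, star_toeplitz]
    congr 1
    funext v
    simp [Letter.coef, entry]
  have hr : ∀ (k : Fin r) (n : ℕ) (ω : Ω),
      ((Real.sqrt n : ℝ) : ℂ)⁻¹ • toeplitz (fun j => u k n j ω) n =
        toeplitz ((Letter.rand k false false).coef u n ω) n := by
    intro k n ω
    rw [smul_toeplitz]
    congr 1
  have htriv : ∀ (k : Fin r) (s c : Bool), (Letter.rand k s c).IsSummable := fun _ _ _ => trivial
  rcases l with i | i | i | i | _ <;> cases b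
  · exact (HasNormalForm.letter (htriv (t i) false false)).congr fun n ω => hr _ n ω
  · exact (HasNormalForm.letter (htriv (t i) true true)).congr fun n ω => hrs _ n ω
  · refine (HasNormalForm.backward.mul
      (HasNormalForm.letter (htriv (h i) false false))).congr fun n ω => ?_
    rw [← hr, Matrix.mul_smul]
    rfl
  · refine ((HasNormalForm.letter (htriv (h i) true true)).mul
      HasNormalForm.backward).congr fun n ω => ?_
    rw [← hrs]
    conv_rhs => rw [← star_backwardIdentity, ← star_mul, Matrix.mul_smul]
    rfl
  · exact HasNormalForm.letter (l := .det (d i)) (hd i)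
  · exact (HasNormalForm.letter (hadj _ (hd i))).congr fun n ω => star_toeplitz _ _
  · exact HasNormalForm.backward.mul (HasNormalForm.letter (l := .det (e i)) (he i))
  · refine ((HasNormalForm.letter (hadj _ (he i))).mul
      HasNormalForm.backward).congr fun n ω => ?_
    have h1 : star (toeplitz (e i) n) =
      toeplitz ((Letter.det fun v => star (e i (-v))).coef u n ω) n := star_toeplitz _ _
    rw [← h1]
    conv_rhs => rw [← star_backwardIdentity, ← star_mul]
    rfl
  · exact HasNormalForm.backward
  · exact HasNormalForm.backward.congr fun n ω => star_backwardIdentity n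

theorem hasNormalForm_starWord {m : ℕ} (t h : Fin m → Fin r) (d e : Fin m → ℤ → ℂ)
    (hd : ∀ i, Summable fun k => ‖d i k‖) (he : ∀ i, Summable fun k => ‖e i k‖)
    (w : List (Label m × Bool)) :
    HasNormalForm u fun n ω => starWord
      (fun i => collection (fun i => u (t i)) (fun i => u (h i)) d e i n ω) w := by
  induction w with
  | nil => exact HasNormalForm.one
  | cons l w ih =>
    refine ((hasNormalForm_collection t h d e hd he l.1 l.2).mul ih).congr fun n ω => ?_
    simp only [starWord, List.map_cons, List.prod_cons]

end NormalForm

/-! ### Joint moments of pair-correlated inputs. -/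

section Moments

variable {Ω : Type*} [MeasurableSpace Ω] {μ : Measure Ω}

/-- A complex random variable with finite moments of all orders. -/
def HasMoments (μ : Measure Ω) (f : Ω → ℂ) : Prop := ∀ p : ℕ, MemLp f (p : ENNReal) μ

/-- Hölder's inequality with both exponents equal to `2 p`. -/
theorem HasMoments.mul {f g : Ω → ℂ} (hf : HasMoments μ f) (hg : HasMoments μ g) :
    HasMoments μ fun ω => f ω * g ω := by
  intro p
  have : ENNReal.HolderTriple ((2 * p : ℕ) : ENNReal) ((2 * p : ℕ) : ENNReal) (p : ENNReal) := by
    refine ⟨?_⟩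
    push_cast
    rw [ENNReal.mul_inv (by simp) (by simp), ← add_mul, ENNReal.inv_two_add_inv_two, one_mul]
  exact MemLp.mul' (hg (2 * p)) (hf (2 * p))

theorem HasMoments.sum {κ : Type*} (s : Finset κ) {f : κ → Ω → ℂ}
    (hf : ∀ k ∈ s, HasMoments μ (f k)) : HasMoments μ fun ω => ∑ k ∈ s, f k ω :=
  fun p => memLp_finsetSum s fun k hk => hf k hk p

theorem HasMoments.const [IsFiniteMeasure μ] (c : ℂ) : HasMoments μ fun _ => c :=
  fun _ => memLp_const c

theorem HasMoments.star {f : Ω → ℂ} (hf : HasMoments μ f) : HasMoments μ fun ω => star (f ω) :=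
  fun p => (hf p).star

theorem HasMoments.prod [IsFiniteMeasure μ] {κ : Type*} (s : Finset κ) {f : κ → Ω → ℂ}
    (hf : ∀ k ∈ s, HasMoments μ (f k)) : HasMoments μ fun ω => ∏ k ∈ s, f k ω := by
  classical
  induction s using Finset.induction_on with
  | empty => simpa using HasMoments.const (μ := μ) 1
  | insert k s hk ih =>
    simp only [Finset.prod_insert hk]
    exact (hf k (Finset.mem_insert_self _ _)).mul
      (ih fun i hi => hf i (Finset.mem_insert_of_mem hi))

theorem HasMoments.integrable {f : Ω → ℂ} (hf : HasMoments μ f) : Integrable f μ := by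
  have := hf 1
  rwa [Nat.cast_one, memLp_one_iff_integrable] at this

theorem memLp_of_integrable_abs_pow {f : Ω → ℝ} (hf : Measurable f)
    (h : ∀ k : ℕ, 1 ≤ k → Integrable (fun ω => |f ω| ^ k) μ) (p : ℕ) :
    MemLp f (p : ENNReal) μ := by
  rcases Nat.eq_zero_or_pos p with rfl | hp
  · rw [Nat.cast_zero, memLp_zero_iff_aestronglyMeasurable]
    exact hf.aestronglyMeasurable
  · rw [← integrable_norm_rpow_iff hf.aestronglyMeasurable (by simpa using hp.ne') (by simp)]
    simpa using h p hp

theorem IsPairCorrelated.hasMoments {a : ℕ → ℤ → Ω → ℂ} {q : CorrParams}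
    (ha : IsPairCorrelated μ a q) {n : ℕ} (hn : 1 ≤ n) (j : ℤ) : HasMoments μ (a n j) := by
  intro p
  obtain ⟨c, hc⟩ := ha.moments
  have hm := ha.measurable n hn j
  refine memLp_re_im_iff.1 ⟨?_, ?_⟩
  · exact memLp_of_integrable_abs_pow (Complex.measurable_re.comp hm)
      (fun k hk => (hc k hk n hn j).1) p
  · exact memLp_of_integrable_abs_pow (Complex.measurable_im.comp hm)
      (fun k hk => (hc k hk n hn j).2.2.1) p

theorem IsPairCorrelated.exists_moment_bound {a : ℕ → ℤ → Ω → ℂ} {q : CorrParams}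
    (ha : IsPairCorrelated μ a q) {k : ℕ} (hk : 1 ≤ k) :
    ∃ C : ℝ, ∀ n, 1 ≤ n → ∀ j, Integrable (fun ω => ‖a n j ω‖ ^ k) μ ∧
      ∫ ω, ‖a n j ω‖ ^ k ∂μ ≤ C := by
  obtain ⟨c, hc⟩ := ha.moments
  -- From `|z| ≤ |Re z| + |Im z|` and convexity of the `k`-th power.
  refine ⟨2 ^ (k - 1) * (c k + c k), fun n hn j => ?_⟩
  obtain ⟨h1, h2, h3, h4⟩ := hc k hk n hn j
  have hle : ∀ ω, ‖a n j ω‖ ^ k ≤ 2 ^ (k - 1) * (|(a n j ω).re| ^ k + |(a n j ω).im| ^ k) :=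
    fun ω => (pow_le_pow_left₀ (norm_nonneg _) (Complex.norm_le_abs_re_add_abs_im _) k).trans
      (add_pow_le (abs_nonneg _) (abs_nonneg _) k)
  have hint := ((h1.add h3).const_mul ((2 : ℝ) ^ (k - 1)))
  have hi : Integrable (fun ω => ‖a n j ω‖ ^ k) μ :=
    hint.mono' ((ha.measurable n hn j).norm.pow_const k).aestronglyMeasurable
      (Eventually.of_forall fun ω => by
        rw [Real.norm_of_nonneg (by positivity)]
        exact hle ω)
  refine ⟨hi, (integral_mono hi hint hle).trans ?_⟩
  simp only [Pi.add_apply]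
  rw [integral_const_mul, integral_add h1 h3]
  gcongr

theorem integral_star_eq (f : Ω → ℂ) : ∫ ω, star (f ω) ∂μ = star (∫ ω, f ω ∂μ) :=
  integral_conj

/-- Second moments of a pair of complex random variables in terms of their real and imaginary
parts. -/
theorem integral_mul_eq {f g : Ω → ℂ} (hf : HasMoments μ f) (hg : HasMoments μ g) :
    ∫ ω, f ω * g ω ∂μ =
      ((∫ ω, (f ω).re * (g ω).re ∂μ : ℝ) - (∫ ω, (f ω).im * (g ω).im ∂μ : ℝ) : ℂ) +
      ((∫ ω, (f ω).re * (g ω).im ∂μ : ℝ) + (∫ ω, (g ω).re * (f ω).im ∂μ : ℝ) : ℂ) *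
        Complex.I := by
  have hr : ∀ {f : Ω → ℂ}, HasMoments μ f → MemLp (fun ω => (f ω).re) 2 μ := fun h =>
    (h 2).re
  have hi : ∀ {f : Ω → ℂ}, HasMoments μ f → MemLp (fun ω => (f ω).im) 2 μ := fun h =>
    (h 2).im
  have h1 : Integrable (fun ω => (f ω).re * (g ω).re) μ := (hr hf).integrable_mul (hr hg)
  have h2 : Integrable (fun ω => (f ω).im * (g ω).im) μ := (hi hf).integrable_mul (hi hg)
  have h3 : Integrable (fun ω => (f ω).re * (g ω).im) μ := (hr hf).integrable_mul (hi hg)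
  have h4 : Integrable (fun ω => (g ω).re * (f ω).im) μ := (hr hg).integrable_mul (hi hf)
  rw [← integral_re_add_im (hf.mul hg).integrable]
  have e1 : ∫ ω, RCLike.re (f ω * g ω) ∂μ =
      (∫ ω, (f ω).re * (g ω).re ∂μ) - ∫ ω, (f ω).im * (g ω).im ∂μ := by
    rw [← integral_sub h1 h2]
    rfl
  have e2 : ∫ ω, RCLike.im (f ω * g ω) ∂μ =
      (∫ ω, (f ω).re * (g ω).im ∂μ) + ∫ ω, (g ω).re * (f ω).im ∂μ := by
    rw [← integral_add h3 h4]
    refine integral_congr_ae (Eventually.of_forall fun ω => ?_)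
    change (f ω * g ω).im = _
    rw [Complex.mul_im]
    ring
  rw [e1, e2]
  simp

/-- Mixed second moments of a pair-correlated array only depend on the signs of the indices. -/
theorem IsPairCorrelated.integral_mul_congr {a : ℕ → ℤ → Ω → ℂ} {q : CorrParams}
    (ha : IsPairCorrelated μ a q) {n n' : ℕ} (hn : 1 ≤ n) (hn' : 1 ≤ n') {v w v' w' : ℤ}
    (h : |v| = |w|) (h' : |v'| = |w'|) (hv : v ≠ 0)
    (hs : SignType.sign v = SignType.sign v') (hs' : SignType.sign w = SignType.sign w')
    (c c' : Bool) :
    ∫ ω, (if c then star (a n v ω) else a n v ω) * (if c' then star (a n w ω) else a n w ω) ∂μ =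
    ∫ ω, (if c then star (a n' v' ω) else a n' v' ω) *
      (if c' then star (a n' w' ω) else a n' w' ω) ∂μ := by
  have hsq : ∀ x : ℝ, x * x = x ^ 2 := fun x => (sq x).symm
  have main : ∀ {n n' : ℕ}, 1 ≤ n → 1 ≤ n' → ∀ {v w v' w' : ℤ}, |v| = |w| → |v'| = |w'| →
      v ≠ 0 → SignType.sign v = SignType.sign v' → SignType.sign w = SignType.sign w' →
      (∫ ω, (a n v ω).re * (a n w ω).re ∂μ = ∫ ω, (a n' v' ω).re * (a n' w' ω).re ∂μ) ∧
      (∫ ω, (a n v ω).im * (a n w ω).im ∂μ = ∫ ω, (a n' v' ω).im * (a n' w' ω).im ∂μ) ∧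
      (∫ ω, (a n v ω).re * (a n w ω).im ∂μ = ∫ ω, (a n' v' ω).re * (a n' w' ω).im ∂μ) := by
    intro n n' hn hn' v w v' w' h h' hv hs hs'
    have hv' : v' ≠ 0 := by rwa [← sign_ne_zero, ← hs, sign_ne_zero]
    -- At negative indices `rho2` and `rho5` persist by symmetry, while `rho6` and `rho4` take the
    -- places of `rho1` and `rho3`. Hence the signs of the indices matter, but nothing else does.
    have hc2 : ∀ {n : ℕ}, 1 ≤ n → ∀ j : ℤ, 1 ≤ -j →
        ∫ ω, (a n j ω).re * (a n (-j) ω).re ∂μ = q.rho2 := by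
      intro n hn j hj
      have := ha.corr2 n hn (-j) hj
      simp only [neg_neg] at this
      simpa only [mul_comm] using this
    have hc5 : ∀ {n : ℕ}, 1 ≤ n → ∀ j : ℤ, 1 ≤ -j →
        ∫ ω, (a n j ω).im * (a n (-j) ω).im ∂μ = q.rho5 := by
      intro n hn j hj
      have := ha.corr5 n hn (-j) hj
      simp only [neg_neg] at this
      simpa only [mul_comm] using this
    have hc6 : ∀ {n : ℕ}, 1 ≤ n → ∀ j : ℤ, 1 ≤ -j →
        ∫ ω, (a n j ω).re * (a n j ω).im ∂μ = q.rho6 := by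
      intro n hn j hj
      simpa only [neg_neg] using ha.corr6 n hn (-j) hj
    have hc4 : ∀ {n : ℕ}, 1 ≤ n → ∀ j : ℤ, 1 ≤ -j →
        ∫ ω, (a n j ω).re * (a n (-j) ω).im ∂μ = q.rho4 := by
      intro n hn j hj
      simpa only [neg_neg] using ha.corr4 n hn (-j) hj
    rcases lt_or_gt_of_ne hv with hv0 | hv0 <;> rcases lt_or_gt_of_ne hv' with hv'0 | hv'0
    · rcases abs_eq_abs.1 h.symm with rfl | rfl <;> rcases abs_eq_abs.1 h'.symm with rfl | rfl
      · simp only [hsq, ha.sq_x n hn, ha.sq_x n' hn', ha.sq_y n hn, ha.sq_y n' hn',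
          hc6 hn w (by omega), hc6 hn' w' (by omega), and_self]
      · rw [sign_neg hv0, sign_pos (by omega)] at hs'
        exact absurd hs' (by decide)
      · rw [sign_neg hv'0, sign_pos (by omega)] at hs'
        exact absurd hs' (by decide)
      · rw [hc2 hn _ (by omega), hc2 hn' _ (by omega), hc5 hn _ (by omega), hc5 hn' _ (by omega),
          hc4 hn _ (by omega), hc4 hn' _ (by omega)]
        simp
    · rw [sign_neg hv0, sign_pos hv'0] at hs
      exact absurd hs (by decide)
    · rw [sign_pos hv0, sign_neg hv'0] at hs
      exact absurd hs (by decide)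
    · rcases abs_eq_abs.1 h.symm with rfl | rfl <;> rcases abs_eq_abs.1 h'.symm with rfl | rfl
      · simp only [hsq, ha.sq_x n hn, ha.sq_x n' hn', ha.sq_y n hn, ha.sq_y n' hn',
          ha.corr1 n hn w (by omega), ha.corr1 n' hn' w' (by omega), and_self]
      · rw [sign_pos hv0, sign_neg (by omega)] at hs'
        exact absurd hs' (by decide)
      · rw [sign_pos hv'0, sign_neg (by omega)] at hs'
        exact absurd hs' (by decide)
      · rw [ha.corr2 n hn _ (by omega), ha.corr2 n' hn' _ (by omega), ha.corr5 n hn _ (by omega),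
          ha.corr5 n' hn' _ (by omega), ha.corr3 n hn _ (by omega), ha.corr3 n' hn' _ (by omega)]
        simp
  have hw : w ≠ 0 := by rw [← abs_ne_zero, ← h, abs_ne_zero]; exact hv
  obtain ⟨m1, m2, m3⟩ := main hn hn' h h' hv hs hs'
  obtain ⟨-, -, m4⟩ := main hn hn' h.symm h'.symm hw hs' hs
  have hmom : ∀ {n : ℕ}, 1 ≤ n → ∀ (c : Bool) (v : ℤ),
      HasMoments μ fun ω => if c then star (a n v ω) else a n v ω := by
    intro n hn c v
    cases c
    · simpa using ha.hasMoments hn v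
    · simpa using (ha.hasMoments hn v).star
  rw [integral_mul_eq (hmom hn c v) (hmom hn c' w),
    integral_mul_eq (hmom hn' c v') (hmom hn' c' w')]
  cases c <;> cases c' <;>
    simp only [if_true, if_false, Bool.false_eq_true, Complex.star_def, Complex.conj_re,
      Complex.conj_im, mul_neg, neg_mul, neg_neg, integral_neg, m1, m2, m3, m4]

variable {r : ℕ} {u : Fin r → ℕ → ℤ → Ω → ℂ} {q : Fin r → CorrParams}

/-- Independence of the arrays combines with independence of the pairs inside each array. -/
theorem iIndepFun_pairs (hu : ∀ k, IsPairCorrelated μ (u k) (q k)) {n : ℕ} (hn : 1 ≤ n)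
    (hindep : iIndepFun (fun (k : Fin r) (ω : Ω) (j : ℤ) => u k n j ω) μ) :
    iIndepFun (fun (x : Fin r × ℕ) (ω : Ω) => (u x.1 n (x.2 : ℤ) ω, u x.1 n (-(x.2 : ℤ)) ω)) μ := by
  refine iIndepFun_uncurry' (X := fun (k : Fin r) (j : ℕ) (ω : Ω) =>
    (u k n (j : ℤ) ω, u k n (-(j : ℤ)) ω)) ?_ ?_ fun k => (hu k).indep n hn
  · exact fun k j => ((hu k).measurable n hn _).prodMk ((hu k).measurable n hn _)
  · exact hindep.comp (fun _ z (j : ℕ) => (z (j : ℤ), z (-(j : ℤ)))) fun _ => by fun_prop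

/-- The function that recovers an entry from the pair of random variables it is built from. -/
def pairEntry (s c : Bool) (v : ℤ) (z : ℂ × ℂ) : ℂ :=
  if c then star (if 0 ≤ (if s then -v else v) then z.1 else z.2)
  else if 0 ≤ (if s then -v else v) then z.1 else z.2

theorem measurable_pairEntry (s c : Bool) (v : ℤ) : Measurable (pairEntry s c v) := by
  unfold pairEntry
  split_ifs <;> fun_prop

theorem entry_eq_pairEntry {Ω : Type*} (u : Fin r → ℕ → ℤ → Ω → ℂ) (k : Fin r) (s c : Bool) (n : ℕ) (v : ℤ) (ω : Ω) :
    entry u k s c n v ω =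
      pairEntry s c v (u k n (v.natAbs : ℤ) ω, u k n (-(v.natAbs : ℤ)) ω) := by
  have h : u k n (if s then -v else v) ω = if 0 ≤ (if s then -v else v) then
      u k n (v.natAbs : ℤ) ω else u k n (-(v.natAbs : ℤ)) ω := by
    split_ifs <;> congr 1 <;> omega
  simp only [entry, pairEntry, h]

variable {ρ : Type*} [Fintype ρ]

/-- The joint moment of the entries with indices `v`. -/
def jointMoment (μ : Measure Ω) (u : Fin r → ℕ → ℤ → Ω → ℂ) (κ : ρ → Fin r × Bool × Bool) (n : ℕ)
    (v : ρ → ℤ) : ℂ :=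
  ∫ ω, ∏ p, entry u (κ p).1 (κ p).2.1 (κ p).2.2 n (v p) ω ∂μ

theorem hasMoments_entry (hu : ∀ k, IsPairCorrelated μ (u k) (q k)) {n : ℕ} (hn : 1 ≤ n)
    (k : Fin r) (s c : Bool) (v : ℤ) : HasMoments μ (entry u k s c n v) := by
  unfold entry
  cases c
  · simpa using (hu k).hasMoments hn _
  · simpa using ((hu k).hasMoments hn _).star

theorem integral_entry (hu : ∀ k, IsPairCorrelated μ (u k) (q k)) {n : ℕ} (hn : 1 ≤ n)
    (k : Fin r) (s c : Bool) (v : ℤ) : ∫ ω, entry u k s c n v ω ∂μ = 0 := by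
  unfold entry
  cases c
  · simpa using (hu k).mean_zero n hn _
  · simp only [if_true]
    rw [integral_star_eq, (hu k).mean_zero n hn, star_zero]

variable [IsProbabilityMeasure μ]

open Classical in
/-- Joint moments factor over the blocks of indices that belong to the same pair of inputs. -/
theorem jointMoment_eq_prod (hu : ∀ k, IsPairCorrelated μ (u k) (q k)) {n : ℕ} (hn : 1 ≤ n)
    (hindep : iIndepFun (fun (k : Fin r) (ω : Ω) (j : ℤ) => u k n j ω) μ)
    (κ : ρ → Fin r × Bool × Bool) (v : ρ → ℤ) {f : ρ → ρ}
    (hf : ∀ p, ((κ (f p)).1, |v (f p)|) = ((κ p).1, |v p|))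
    (hf' : ∀ p p', ((κ p).1, |v p|) = ((κ p').1, |v p'|) → f p = f p') :
    jointMoment μ u κ n v = ∏ b : {b : ρ // f b = b},
      ∫ ω, ∏ p with f p = b, entry u (κ p).1 (κ p).2.1 (κ p).2.2 n (v p) ω ∂μ := by
  -- Different blocks use different independent pairs, labelled by the array and the absolute value
  -- of the index.
  let key : {b : ρ // f b = b} → Fin r × ℕ := fun b => ((κ b).1, (v b).natAbs)
  have hkey : Function.Injective key := by
    intro b c hbc
    simp only [key, Prod.mk.injEq] at hbc
    have := hf' b c (Prod.ext hbc.1 (by simp only [Int.abs_eq_natAbs, hbc.2]))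
    exact Subtype.ext (by rw [← b.2, ← c.2, this])
  let X : {b : ρ // f b = b} → Ω → ℂ := fun b ω =>
    ∏ p with f p = b, entry u (κ p).1 (κ p).2.1 (κ p).2.2 n (v p) ω
  have hX : iIndepFun X μ := by
    have h1 := (iIndepFun_pairs hu hn hindep).precomp hkey
    have h2 := h1.comp (fun b z => ∏ p with f p = b, pairEntry (κ p).2.1 (κ p).2.2 (v p) z)
      (fun b => Finset.measurable_prod _ fun p _ => measurable_pairEntry _ _ _)
    convert h2 using 1
    funext b ω
    refine Finset.prod_congr rfl fun p hp => ?_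
    have hp' : f p = b := (Finset.mem_filter.1 hp).2
    have h3 := hf p
    rw [hp', Prod.mk.injEq] at h3
    have h4 : (v b).natAbs = (v p).natAbs := by
      have := h3.2
      simp only [Int.abs_eq_natAbs, Nat.cast_inj] at this
      exact this
    simp only [entry_eq_pairEntry, key, h3.1, h4]
  have hmeas : ∀ b, AEStronglyMeasurable (X b) μ := fun b =>
    (HasMoments.prod _ fun p _ => hasMoments_entry hu hn _ _ _ _).integrable.aestronglyMeasurable
  have h5 := hX.integral_fun_prod_eq_prod_integral hmeas
  rw [jointMoment, ← h5]
  congr 1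
  funext ω
  have hfb : ∀ p, f (f p) = f p := fun p => hf' _ _ (hf p)
  rw [← Finset.prod_fiberwise Finset.univ (fun p => (⟨f p, hfb p⟩ : {b : ρ // f b = b}))]
  refine Finset.prod_congr rfl fun b _ => Finset.prod_congr ?_ fun _ _ => rfl
  ext p
  simp [Subtype.ext_iff]

/-- A product of `card ρ` factors is at most the `card ρ`-th power of the largest one, hence at most
the sum of all these powers, whose expectations are uniformly bounded. -/
theorem norm_jointMoment_le (hu : ∀ k, IsPairCorrelated μ (u k) (q k))
    (κ : ρ → Fin r × Bool × Bool) :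
    ∃ M : ℝ, ∀ n, 1 ≤ n → ∀ v, ‖jointMoment μ u κ n v‖ ≤ M := by
  rcases isEmpty_or_nonempty ρ with hρ | hρ
  · exact ⟨1, fun n hn v => by simp [jointMoment]⟩
  have hk : 1 ≤ Fintype.card ρ := Fintype.card_pos
  choose C hC using fun k => (hu k).exists_moment_bound hk
  refine ⟨∑ p, C (κ p).1, fun n hn v => ?_⟩
  have hnorm : ∀ p ω, ‖entry u (κ p).1 (κ p).2.1 (κ p).2.2 n (v p) ω‖ =
      ‖u (κ p).1 n (if (κ p).2.1 then -(v p) else v p) ω‖ := by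
    intro p ω
    unfold entry
    split_ifs <;> simp
  have hle : ∀ ω, ‖∏ p, entry u (κ p).1 (κ p).2.1 (κ p).2.2 n (v p) ω‖ ≤
      ∑ p, ‖u (κ p).1 n (if (κ p).2.1 then -(v p) else v p) ω‖ ^ Fintype.card ρ := by
    intro ω
    rw [norm_prod]
    simp only [hnorm]
    obtain ⟨p₀, -, hp₀⟩ := Finset.exists_max_image Finset.univ
      (fun p => ‖u (κ p).1 n (if (κ p).2.1 then -(v p) else v p) ω‖) Finset.univ_nonempty
    calc ∏ p, ‖u (κ p).1 n (if (κ p).2.1 then -(v p) else v p) ω‖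
        ≤ ∏ _p : ρ, ‖u (κ p₀).1 n (if (κ p₀).2.1 then -(v p₀) else v p₀) ω‖ :=
          Finset.prod_le_prod (fun p _ => norm_nonneg _) fun p hp => hp₀ p hp
      _ = ‖u (κ p₀).1 n (if (κ p₀).2.1 then -(v p₀) else v p₀) ω‖ ^ Fintype.card ρ := by
          rw [Finset.prod_const, Finset.card_univ]
      _ ≤ _ := Finset.single_le_sum
          (f := fun p => ‖u (κ p).1 n (if (κ p).2.1 then -(v p) else v p) ω‖ ^ Fintype.card ρ)
          (fun p _ => by positivity) (Finset.mem_univ p₀)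
  refine (norm_integral_le_of_norm_le (integrable_finsetSum _ fun p _ =>
    (hC (κ p).1 n hn _).1) (Eventually.of_forall hle)).trans ?_
  rw [integral_finsetSum _ fun p _ => (hC (κ p).1 n hn _).1]
  exact Finset.sum_le_sum fun p _ => (hC (κ p).1 n hn _).2

/-- A block with a single entry contributes a zero mean. For a generic vector every block has one or
two entries, so the moment is a product of means and second moments, and the latter depend only on
signs. -/
theorem isMomentFunction_jointMoment (hu : ∀ k, IsPairCorrelated μ (u k) (q k))
    (hindep : ∀ n, 1 ≤ n → iIndepFun (fun (k : Fin r) (ω : Ω) (j : ℤ) => u k n j ω) μ)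
    (κ : ρ → Fin r × Bool × Bool) : IsMomentFunction (jointMoment μ u κ) := by
  classical
  have hfib : ∀ {v : ρ → ℤ} {f : ρ → ρ},
      (∀ p, ((κ (f p)).1, |v (f p)|) = ((κ p).1, |v p|)) →
      (∀ p p', ((κ p).1, |v p|) = ((κ p').1, |v p'|) → f p = f p') → ∀ b, f b = b → ∀ p,
      f p = b ↔ (κ p).1 = (κ b).1 ∧ |v p| = |v b| := by
    intro v f hf hf' b hb p
    constructor
    · intro h
      have := hf p
      rw [h, Prod.mk.injEq] at this
      exact ⟨this.1.symm, this.2.symm⟩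
    · rintro ⟨h1, h2⟩
      rw [← hb]
      exact hf' _ _ (Prod.ext h1 h2)
  refine ⟨norm_jointMoment_le hu κ, ?_, ?_⟩
  · intro n hn v hv
    simp only [Partnered, not_forall, not_exists, not_and] at hv
    obtain ⟨p₀, hp₀⟩ := hv
    obtain ⟨f, hf, hf'⟩ := exists_representatives fun p => ((κ p).1, |v p|)
    rw [jointMoment_eq_prod hu hn (hindep n hn) κ v hf hf']
    have hfp : f p₀ = p₀ := by
      by_contra hne
      exact hp₀ _ hne (congrArg Prod.snd (hf p₀))
    refine Finset.prod_eq_zero (Finset.mem_univ ⟨p₀, hfp⟩) ?_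
    have hset : (Finset.univ.filter fun p => f p = p₀) = {p₀} := by
      ext p
      simp only [Finset.mem_filter, Finset.mem_univ, true_and, Finset.mem_singleton,
        hfib hf hf' p₀ hfp]
      refine ⟨fun h => ?_, fun h => by simp [h]⟩
      by_contra hne
      exact hp₀ p hne h.2
    simp only [hset, Finset.prod_singleton]
    exact integral_entry hu hn _ _ _ _
  · intro n n' hn hn' v v' hpat hgen
    obtain ⟨f, hf, hf'⟩ := exists_representatives fun p => ((κ p).1, |v p|)
    have hg : ∀ p, ((κ (f p)).1, |v' (f p)|) = ((κ p).1, |v' p|) := by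
      intro p
      have := hf p
      simp only [Prod.mk.injEq] at this ⊢
      exact ⟨this.1, (abs_eq_iff_of_pattern_eq hpat _ _).1 this.2⟩
    have hg' : ∀ p p', ((κ p).1, |v' p|) = ((κ p').1, |v' p'|) → f p = f p' := by
      intro p p' h
      rw [Prod.mk.injEq] at h
      exact hf' _ _ (Prod.ext h.1 ((abs_eq_iff_of_pattern_eq hpat _ _).2 h.2))
    rw [jointMoment_eq_prod hu hn (hindep n hn) κ v hf hf',
      jointMoment_eq_prod hu hn' (hindep n' hn') κ v' hg hg']
    refine Finset.prod_congr rfl fun b _ => ?_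
    -- The partner `b'` lies in the block of `b` only if it comes from the same array; otherwise the
    -- block is a singleton and both sides vanish.
    obtain ⟨b', hbb', hb'⟩ := hgen.2 b
    by_cases hk : (κ b').1 = (κ b).1
    · have habs : |v b'| = |v b| := (hb' b').2 (Or.inr rfl)
      have hset : (Finset.univ.filter fun p => f p = b) = {b.1, b'} := by
        ext p
        simp only [Finset.mem_filter, Finset.mem_univ, true_and, Finset.mem_insert,
          Finset.mem_singleton, hfib hf hf' b b.2, hb']
        refine ⟨fun h => h.2, fun h => ⟨?_, h⟩⟩
        rcases h with rfl | rfl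
        · rfl
        · exact hk
      simp only [hset, Finset.prod_pair hbb'.symm]
      have hsgn : ∀ (s : Bool) (x y : ℤ), SignType.sign x = SignType.sign y →
          SignType.sign (if s then -x else x) = SignType.sign (if s then -y else y) := by
        intro s x y h
        cases s
        · simpa using h
        · simp [Left.sign_neg, h]
      have habs' : ∀ (s s' : Bool) (x y : ℤ), |x| = |y| →
          |if s then -x else x| = |if s' then -y else y| := by
        intro s s' x y h
        cases s <;> cases s' <;> simpa using h
      have hne : (if (κ b).2.1 then -(v b) else v b) ≠ 0 := by
        have := hgen.1 b
        split_ifs <;> simpa using this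
      simp only [entry, hk]
      exact (hu (κ b).1).integral_mul_congr hn hn' (habs' _ _ _ _ habs.symm)
        (habs' _ _ _ _ ((abs_eq_iff_of_pattern_eq hpat _ _).1 habs.symm)) hne
        (hsgn _ _ _ (sign_eq_of_pattern_eq hpat _)) (hsgn _ _ _ (sign_eq_of_pattern_eq hpat _))
        _ _
    · have hset : (Finset.univ.filter fun p => f p = b) = {b.1} := by
        ext p
        simp only [Finset.mem_filter, Finset.mem_univ, true_and, Finset.mem_singleton,
          hfib hf hf' b b.2, hb']
        refine ⟨fun h => ?_, fun h => by simp [h]⟩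
        rcases h.2 with h2 | h2
        · exact h2
        · exact absurd (h2 ▸ h.1) hk
      simp only [hset, Finset.prod_singleton]
      rw [integral_entry hu hn, integral_entry hu hn']

end Moments

/-! ### The free `*`-algebra that carries the limit. -/

section FreeStarAlgebra

variable {ι : Type*}

/-- The free unital complex algebra on the letters `x i` and `(x i)*`. -/
abbrev FreeStar (ι : Type*) : Type _ := MonoidAlgebra ℂ (FreeMonoid (ι × Bool))

/-- The adjoint of a word. -/
def wordStar (w : FreeMonoid (ι × Bool)) : FreeMonoid (ι × Bool) :=
  FreeMonoid.ofList (w.toList.reverse.map fun l => (l.1, !l.2))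

theorem wordStar_mul (v w : FreeMonoid (ι × Bool)) :
    wordStar (v * w) = wordStar w * wordStar v := by
  simp [wordStar, FreeMonoid.toList_mul, FreeMonoid.ofList_append]

theorem wordStar_wordStar (w : FreeMonoid (ι × Bool)) : wordStar (wordStar w) = w := by
  simp [wordStar, Function.comp_def]

/-- The conjugate-linear extension of the adjoint of words. -/
def freeStarHom (ι : Type*) : FreeStar ι →+ FreeStar ι :=
  MonoidAlgebra.liftNC ((MonoidAlgebra.singleAddHom 1).comp (starAddEquiv : ℂ ≃+ ℂ).toAddMonoidHom)
    fun w => MonoidAlgebra.single (wordStar w) 1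

theorem freeStarHom_single (w : FreeMonoid (ι × Bool)) (c : ℂ) :
    freeStarHom ι (MonoidAlgebra.single w c) = MonoidAlgebra.single (wordStar w) (star c) := by
  rw [freeStarHom, MonoidAlgebra.liftNC_single]
  simp [MonoidAlgebra.singleAddHom, MonoidAlgebra.single_mul_single]

theorem freeStarHom_mul (f g : FreeStar ι) :
    freeStarHom ι (f * g) = freeStarHom ι g * freeStarHom ι f := by
  induction f using MonoidAlgebra.induction_linear with
  | zero => simp
  | add f f' hf hf' => rw [add_mul, map_add, map_add, hf, hf', mul_add]
  | single v c =>
    induction g using MonoidAlgebra.induction_linear with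
    | zero => simp
    | add g g' hg hg' => rw [mul_add, map_add, map_add, hg, hg', add_mul]
    | single w d =>
      simp only [MonoidAlgebra.single_mul_single, freeStarHom_single, wordStar_mul, star_mul]

instance : StarRing (FreeStar ι) where
  star := freeStarHom ι
  star_involutive f := by
    induction f using MonoidAlgebra.induction_linear with
    | zero => simp
    | add f g hf hg => rw [map_add, map_add, hf, hg]
    | single w c => rw [freeStarHom_single, freeStarHom_single, wordStar_wordStar, star_star]
  star_mul := freeStarHom_mul
  star_add f g := map_add _ f g

theorem star_single (w : FreeMonoid (ι × Bool)) (c : ℂ) :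
    star (MonoidAlgebra.single w c : FreeStar ι) = MonoidAlgebra.single (wordStar w) (star c) :=
  freeStarHom_single w c

instance : StarModule ℂ (FreeStar ι) where
  star_smul c f := by
    induction f using MonoidAlgebra.induction_linear with
    | zero => simp
    | add f g hf hg => rw [smul_add, star_add, star_add, hf, hg, smul_add]
    | single w d =>
      simp only [MonoidAlgebra.smul_single, star_single, smul_eq_mul, star_mul, mul_comm]

variable {R : Type*} [Ring R] [StarRing R]

theorem starWord_wordStar (x : ι → R) (w : FreeMonoid (ι × Bool)) :
    starWord x (wordStar w).toList = star (starWord x w.toList) := by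
  simp only [starWord, wordStar, FreeMonoid.toList_ofList]
  generalize w.toList = l
  induction l with
  | nil => simp
  | cons a l ih =>
    simp only [List.reverse_cons, List.map_append, List.prod_append, ih, List.map_cons,
      List.prod_cons, star_mul, List.map_nil, List.prod_nil, mul_one]
    rcases a with ⟨a, _ | _⟩ <;> simp

variable [Algebra ℂ R]

/-- Evaluation of noncommutative `*`-polynomials. -/
def evalStar (x : ι → R) : FreeStar ι →ₐ[ℂ] R :=
  MonoidAlgebra.lift ℂ R _ (FreeMonoid.lift fun l : ι × Bool =>
    if l.2 then star (x l.1) else x l.1)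

theorem evalStar_single (x : ι → R) (w : FreeMonoid (ι × Bool)) (c : ℂ) :
    evalStar x (MonoidAlgebra.single w c) = c • starWord x w.toList := by
  rw [evalStar, MonoidAlgebra.lift_single, FreeMonoid.lift_apply, starWord]

theorem evalStar_star [StarModule ℂ R] (x : ι → R) (f : FreeStar ι) :
    evalStar x (star f) = star (evalStar x f) := by
  induction f using MonoidAlgebra.induction_linear with
  | zero => simp
  | add f g hf hg => rw [star_add, map_add, map_add, hf, hg, star_add]
  | single w c => rw [star_single, evalStar_single, evalStar_single, starWord_wordStar, star_smul]

/-- The generators of the free `*`-algebra. -/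
def freeGen (i : ι) : FreeStar ι := MonoidAlgebra.single (FreeMonoid.of (i, false)) 1

theorem starWord_freeGen (w : List (ι × Bool)) :
    starWord (freeGen (ι := ι)) w = MonoidAlgebra.single (FreeMonoid.ofList w) 1 := by
  induction w with
  | nil => rfl
  | cons a w ih =>
    have h : (if a.2 then star (freeGen a.1) else freeGen a.1 : FreeStar ι) =
        MonoidAlgebra.single (FreeMonoid.of a) 1 := by
      rcases a with ⟨a, _ | _⟩
      · rfl
      · simp [freeGen, star_single, wordStar]
    simp only [starWord, List.map_cons, List.prod_cons, h] at ih ⊢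
    rw [ih, MonoidAlgebra.single_mul_single, one_mul, ← FreeMonoid.ofList_cons]

/-- The linear functional with prescribed values on words. -/
def freeFunctional (L : List (ι × Bool) → ℂ) : FreeStar ι →ₗ[ℂ] ℂ where
  toFun f := Finsupp.linearCombination ℂ (fun w : FreeMonoid (ι × Bool) => L w.toList) f.coeff
  map_add' f g := by simp
  map_smul' c f := by simp

theorem freeFunctional_single (L : List (ι × Bool) → ℂ) (w : FreeMonoid (ι × Bool)) (c : ℂ) :
    freeFunctional L (MonoidAlgebra.single w c) = c * L w.toList := by
  simp [freeFunctional]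

end FreeStarAlgebra

/-! ### From convergence of all words to a limiting state. -/

section Limit

variable {Ω : Type*} [MeasurableSpace Ω] {μ : Measure Ω} {n : ℕ}

theorem HasAllMoments.mul {A B : Ω → Matrix (Fin n) (Fin n) ℂ} (hA : HasAllMoments μ A)
    (hB : HasAllMoments μ B) : HasAllMoments μ fun ω => A ω * B ω := by
  intro i j
  simp only [Matrix.mul_apply]
  exact HasMoments.sum (μ := μ) _ fun k _ => HasMoments.mul (hA i k) (hB k j)

theorem HasAllMoments.star {A : Ω → Matrix (Fin n) (Fin n) ℂ} (hA : HasAllMoments μ A) :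
    HasAllMoments μ fun ω => star (A ω) := by
  intro i j
  simp only [Matrix.star_apply]
  exact HasMoments.star (μ := μ) (hA j i)

theorem HasAllMoments.add {A B : Ω → Matrix (Fin n) (Fin n) ℂ} (hA : HasAllMoments μ A)
    (hB : HasAllMoments μ B) : HasAllMoments μ fun ω => A ω + B ω :=
  fun i j p => (hA i j p).add (hB i j p)

theorem HasAllMoments.smul {A : Ω → Matrix (Fin n) (Fin n) ℂ} (hA : HasAllMoments μ A) (c : ℂ) :
    HasAllMoments μ fun ω => c • A ω :=
  fun i j p => (hA i j p).const_smul c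

theorem HasAllMoments.const [IsFiniteMeasure μ] (A : Matrix (Fin n) (Fin n) ℂ) :
    HasAllMoments μ fun _ => A :=
  fun i j _ => memLp_const (A i j)

theorem HasAllMoments.integrable_trace {A : Ω → Matrix (Fin n) (Fin n) ℂ}
    (hA : HasAllMoments μ A) : Integrable (fun ω => (A ω).trace) μ :=
  integrable_finsetSum _ fun i _ => HasMoments.integrable (μ := μ) (hA i i)

theorem HasAllMoments.starWord [IsFiniteMeasure μ] {ι : Type*}
    {A : ι → Ω → Matrix (Fin n) (Fin n) ℂ} (hA : ∀ i, HasAllMoments μ (A i))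
    (w : List (ι × Bool)) : HasAllMoments μ fun ω => starWord (fun i => A i ω) w := by
  induction w with
  | nil => exact HasAllMoments.const 1
  | cons a w ih =>
    simp only [ToeplitzHankel.starWord, List.map_cons, List.prod_cons] at ih ⊢
    refine HasAllMoments.mul ?_ ih
    rcases a with ⟨a, _ | _⟩
    · simpa using hA a
    · simpa using (hA a).star

theorem HasAllMoments.evalStar [IsFiniteMeasure μ] {ι : Type*}
    {A : ι → Ω → Matrix (Fin n) (Fin n) ℂ} (hA : ∀ i, HasAllMoments μ (A i))
    (f : FreeStar ι) : HasAllMoments μ fun ω => evalStar (fun i => A i ω) f := by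
  induction f using MonoidAlgebra.induction_linear with
  | zero => simpa using HasAllMoments.const (μ := μ) (n := n) 0
  | add f g hf hg => simpa using hf.add hg
  | single w c =>
    simp only [evalStar_single]
    exact (HasAllMoments.starWord hA w.toList).smul c

theorem expTrace_smul (c : ℂ) (A : Ω → Matrix (Fin n) (Fin n) ℂ) :
    expTrace μ (fun ω => c • A ω) = c * expTrace μ A := by
  simp only [expTrace, Matrix.trace_smul, smul_eq_mul, integral_const_mul]
  ring

/-- The trace is the sum of the squared moduli of the entries. Membership in a closed set is the
form that passes to the limit. -/
theorem expTrace_mul_star_mem (A : Ω → Matrix (Fin n) (Fin n) ℂ) :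
    expTrace μ (fun ω => A ω * star (A ω)) ∈ {z : ℂ | 0 ≤ z.re ∧ z.im = 0} := by
  have h : ∀ ω, (A ω * star (A ω)).trace =
      ((∑ i, ∑ j, Complex.normSq (A ω i j) : ℝ) : ℂ) := by
    intro ω
    simp only [Matrix.trace, Matrix.diag_apply, Matrix.mul_apply, Matrix.star_apply,
      Complex.ofReal_sum, Complex.star_def, Complex.mul_conj]
  have h2 : expTrace μ (fun ω => A ω * star (A ω)) =
      (((n : ℝ)⁻¹ * ∫ ω, ∑ i, ∑ j, Complex.normSq (A ω i j) ∂μ : ℝ) : ℂ) := by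
    rw [expTrace, Complex.ofReal_mul, ← integral_complex_ofReal]
    simp only [h]
    simp
  rw [h2]
  refine ⟨?_, Complex.ofReal_im _⟩
  rw [Complex.ofReal_re]
  exact mul_nonneg (by positivity) (integral_nonneg fun ω =>
    Finset.sum_nonneg fun i _ => Finset.sum_nonneg fun j _ => Complex.normSq_nonneg _)

/-- A family of sequences of random matrices for which the normalized expected traces of all words
converge has a joint limit in `*`-distribution. -/
theorem convergeJointly_of_tendsto [IsProbabilityMeasure μ] {ι : Type}
    {A : ι → (n : ℕ) → Ω → Matrix (Fin n) (Fin n) ℂ}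
    (hA : ∀ i n, 1 ≤ n → HasAllMoments μ (A i n))
    (hlim : ∀ w : List (ι × Bool), ∃ L : ℂ,
      Tendsto (fun n : ℕ => expTrace μ (fun ω => starWord (fun i => A i n ω) w)) atTop (𝓝 L)) :
    ConvergeJointly μ A := by
  choose L hL using hlim
  have hconv : ∀ f : FreeStar ι, Tendsto
      (fun n : ℕ => expTrace μ (fun ω => evalStar (fun i => A i n ω) f)) atTop
      (𝓝 (freeFunctional L f)) := by
    intro f
    induction f using MonoidAlgebra.induction_linear with
    | zero => simp [expTrace]
    | add f g hf hg =>
      rw [map_add]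
      refine (hf.add hg).congr' ?_
      filter_upwards [eventually_ge_atTop 1] with n hn
      simp only [expTrace, map_add, Matrix.trace_add]
      rw [integral_add (HasAllMoments.evalStar (fun i => hA i n hn) f).integrable_trace
        (HasAllMoments.evalStar (fun i => hA i n hn) g).integrable_trace, mul_add]
    | single w c =>
      simp only [evalStar_single, expTrace_smul, freeFunctional_single]
      exact (hL w.toList).const_mul c
  refine ⟨hA, FreeStar ι, inferInstance, inferInstance, inferInstance, inferInstance,
    freeFunctional L, freeGen, ⟨?_, fun f => ?_⟩, fun w => ?_⟩
  -- The state of the identity is `1` only for `n ≥ 1`; at `n = 0` it is `0`.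
  · refine tendsto_nhds_unique (hconv 1) (tendsto_const_nhds.congr' ?_)
    filter_upwards [eventually_ge_atTop 1] with n hn
    have hn0 : (n : ℂ) ≠ 0 := by exact_mod_cast (by omega : n ≠ 0)
    simp [expTrace, hn0]
  · have hclosed : IsClosed {z : ℂ | 0 ≤ z.re ∧ z.im = 0} :=
      (isClosed_le continuous_const Complex.continuous_re).inter
        (isClosed_eq Complex.continuous_im continuous_const)
    have hmem := hclosed.mem_of_tendsto (hconv (f * star f)) (Eventually.of_forall fun n => by
      simp only [map_mul, evalStar_star]
      exact expTrace_mul_star_mem _)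
    exact ⟨_, hmem.1, Complex.ext (by simp) (by simpa using hmem.2)⟩
  · rw [starWord_freeGen, freeFunctional_single, one_mul]
    exact hL w

end Limit

/-! ### Convergence of the normalized expected trace of a word. -/

section Words

/-- The function on a type with prescribed restrictions to a subtype and its complement. -/
def glue {α : Type*} {P : α → Prop} [DecidablePred P] (v : {a // P a} → ℤ) (w : {a // ¬ P a} → ℤ) :
    α → ℤ :=
  fun a => if h : P a then v ⟨a, h⟩ else w ⟨a, h⟩

theorem glue_pos {α : Type*} {P : α → Prop} [DecidablePred P] (v : {a // P a} → ℤ)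
    (w : {a // ¬ P a} → ℤ) (a : {a // P a}) : glue v w a = v a := by
  simp [glue, a.2]

theorem glue_neg {α : Type*} {P : α → Prop} [DecidablePred P] (v : {a // P a} → ℤ)
    (w : {a // ¬ P a} → ℤ) (a : {a // ¬ P a}) : glue v w a = w a := by
  simp [glue, a.2]

theorem sum_box_glue {α : Type*} [Fintype α] {P : α → Prop} [DecidablePred P] (n : ℕ)
    (F : (α → ℤ) → ℂ) :
    ∑ x ∈ box α n, F x = ∑ w ∈ box {a // ¬ P a} n, ∑ v ∈ box {a // P a} n, F (glue v w) := by
  rw [← Finset.sum_product']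
  refine Finset.sum_nbij' (fun x => (fun a => x a, fun a => x a)) (fun y => glue y.2 y.1)
    ?_ ?_ ?_ ?_ ?_
  · intro x hx
    rw [mem_box] at hx
    simp only [Finset.mem_product, mem_box]
    exact ⟨fun a => hx a, fun a => hx a⟩
  · intro y hy
    simp only [Finset.mem_product, mem_box] at hy
    rw [mem_box]
    intro a
    unfold glue
    split_ifs
    · exact hy.2 _
    · exact hy.1 _
  · intro x _
    funext a
    simp [glue]
  · intro y _
    refine Prod.ext (funext fun a => glue_neg _ _ a) (funext fun a => glue_pos _ _ a)
  · intro x _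
    congr 1
    funext a
    simp [glue]

theorem sum_box_option {ρ : Type*} [Fintype ρ] (n : ℕ) (F : (ρ → ℤ) → ℤ → ℂ) :
    ∑ x ∈ box (Option ρ) n, F (fun q => x (some q)) (x none) =
      ∑ v ∈ box ρ n, ∑ i ∈ Finset.Icc (-(n : ℤ)) n, F v i := by
  rw [← Finset.sum_product']
  refine Finset.sum_nbij' (fun x => (fun q => x (some q), x none))
    (fun y o => o.elim y.2 y.1) ?_ ?_ ?_ ?_ ?_
  · intro x hx
    rw [mem_box] at hx
    simp only [Finset.mem_product, mem_box, Finset.mem_Icc]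
    exact ⟨fun q => hx _, hx _⟩
  · intro y hy
    simp only [Finset.mem_product, mem_box, Finset.mem_Icc] at hy
    rw [mem_box]
    rintro (_ | q)
    · exact hy.2
    · exact hy.1 q
  · intro x _
    funext o
    cases o <;> rfl
  · intro y _
    rfl
  · intro x _
    rfl

/-- A finite set of index vectors lies in a product of finite sets, over which the sum factors; so
the product of the full sums bounds all partial sums. -/
theorem summable_prod_pi {η : Type*} [Fintype η] {f : η → ℤ → ℝ} (h0 : ∀ p v, 0 ≤ f p v)
    (hf : ∀ p, Summable (f p)) : Summable fun w : η → ℤ => ∏ p, f p (w p) := by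
  classical
  refine summable_of_sum_le (c := ∏ p, ∑' v, f p v)
    (fun w => Finset.prod_nonneg fun p _ => h0 p _) fun s => ?_
  have hsub : s ⊆ Fintype.piFinset fun p => s.image fun w => w p := by
    intro w hw
    rw [Fintype.mem_piFinset]
    exact fun p => Finset.mem_image_of_mem _ hw
  calc ∑ w ∈ s, ∏ p, f p (w p)
      ≤ ∑ w ∈ Fintype.piFinset fun p => s.image fun w => w p, ∏ p, f p (w p) :=
        Finset.sum_le_sum_of_subset_of_nonneg hsub fun w _ _ =>
          Finset.prod_nonneg fun p _ => h0 p _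
    _ = ∏ p, ∑ v ∈ s.image fun w => w p, f p v := (Finset.prod_univ_sum _ _).symm
    _ ≤ _ := Finset.prod_le_prod (fun p _ => Finset.sum_nonneg fun v _ => h0 p v) fun p _ =>
        (hf p).sum_le_tsum _ fun v _ => h0 p v

variable {Ω : Type*} [MeasurableSpace Ω] {μ : Measure Ω} [IsProbabilityMeasure μ] {r : ℕ}
  {u : Fin r → ℕ → ℤ → Ω → ℂ} {q : Fin r → CorrParams}

/-- Whether a letter is random. -/
def Letter.IsRand : Letter r → Bool
  | .rand _ _ _ => true
  | .det _ => false

open Classical in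
/-- The normalized expected trace of a product of Toeplitz matrices is a sum over the indices of the
deterministic inputs of normalized sums of joint moments of the random inputs. -/
theorem expTrace_prod_eq (hu : ∀ k, IsPairCorrelated μ (u k) (q k)) {k : ℕ}
    (lt : Fin k → Letter r) (δ : Bool)
    (κ : {p // (lt p).IsRand = true} → Fin r × Bool × Bool)
    (hκ : ∀ p : {p // (lt p).IsRand = true}, lt p = .rand (κ p).1 (κ p).2.1 (κ p).2.2)
    (d : {p // ¬ (lt p).IsRand = true} → ℤ → ℂ)
    (hd : ∀ p : {p // ¬ (lt p).IsRand = true}, lt p = .det (d p))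
    {n : ℕ} (hn : 1 ≤ n) :
    expTrace μ (fun ω => (List.ofFn fun p => toeplitz ((lt p).coef u n ω) n).prod *
      backwardPow δ n) =
    ∑ w ∈ box {p // ¬ (lt p).IsRand = true} n, (∏ p, d p (w p)) *
      momentSum (jointMoment μ u κ) n fun x =>
        IsClosedPath n δ (List.ofFn (glue (fun p => x (some p)) w)) (x none) := by
  have hcoef : ∀ ω (v : Fin k → ℤ), ∏ p, (lt p).coef u n ω (v p) =
      (((Real.sqrt n : ℝ) : ℂ)⁻¹ ^ Fintype.card {p // (lt p).IsRand = true} *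
        ∏ p : {p // ¬ (lt p).IsRand = true}, d p (v p)) *
      ∏ p : {p // (lt p).IsRand = true}, entry u (κ p).1 (κ p).2.1 (κ p).2.2 n (v p) ω := by
    intro ω v
    rw [← Fintype.prod_subtype_mul_prod_subtype (fun p => (lt p).IsRand = true)]
    have h1 : ∏ p : {p // (lt p).IsRand = true}, (lt p).coef u n ω (v p) =
        ((Real.sqrt n : ℝ) : ℂ)⁻¹ ^ Fintype.card {p // (lt p).IsRand = true} *
        ∏ p : {p // (lt p).IsRand = true}, entry u (κ p).1 (κ p).2.1 (κ p).2.2 n (v p) ω := by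
      rw [← Finset.card_univ, ← Finset.prod_const, ← Finset.prod_mul_distrib]
      exact Finset.prod_congr rfl fun p _ => by rw [hκ p]; rfl
    have h2 : ∏ p : {p // ¬ (lt p).IsRand = true}, (lt p).coef u n ω (v p) =
        ∏ p : {p // ¬ (lt p).IsRand = true}, d p (v p) :=
      Finset.prod_congr rfl fun p _ => by rw [hd p]; rfl
    rw [h1, h2]
    ring
  have hint : ∀ v : {p // (lt p).IsRand = true} → ℤ, Integrable (fun ω =>
      ∏ p, entry u (κ p).1 (κ p).2.1 (κ p).2.2 n (v p) ω) μ := fun v =>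
    (HasMoments.prod _ fun p _ => hasMoments_entry hu hn _ _ _ _).integrable
  rw [expTrace]
  simp only [trace_prod_toeplitz, hcoef]
  rw [integral_finsetSum _ fun v _ =>
    ((hint fun p => v p).const_mul _).mul_const _]
  simp only [integral_mul_const, integral_const_mul]
  -- Deterministic indices go outside, random ones inside, where the starting point joins them as
  -- the coordinate `none`.
  rw [sum_box_glue (P := fun p => (lt p).IsRand = true), Finset.mul_sum]
  refine Finset.sum_congr rfl fun w _ => ?_
  simp only [glue_pos, glue_neg, momentSum, normFactor]
  rw [Finset.sum_filter]
  have h3 := sum_box_option n fun (v : {p // (lt p).IsRand = true} → ℤ) (i : ℤ) =>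
    if IsClosedPath n δ (List.ofFn (glue v w)) i then jointMoment μ u κ n v else 0
  rw [h3, Finset.mul_sum, Finset.mul_sum, Finset.mul_sum]
  refine Finset.sum_congr rfl fun v _ => ?_
  have h4 : ∑ i ∈ Finset.Icc (-(n : ℤ)) n,
      (if IsClosedPath n δ (List.ofFn (glue v w)) i then jointMoment μ u κ n v else 0) =
      jointMoment μ u κ n v * ∑ i ∈ Finset.Icc (-(n : ℤ)) n,
        if IsClosedPath n δ (List.ofFn (glue v w)) i then 1 else 0 := by
    rw [Finset.mul_sum]
    exact Finset.sum_congr rfl fun i _ => by split_ifs <;> simp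
  rw [h4, jointMoment]
  ring

/-- For fixed deterministic indices the inner moment sum converges; the product of the norms of the
deterministic coefficients times a uniform bound dominates the outer sum. -/
theorem tendsto_expTrace_prod (hu : ∀ k, IsPairCorrelated μ (u k) (q k))
    (hindep : ∀ n, 1 ≤ n → iIndepFun (fun (k : Fin r) (ω : Ω) (j : ℤ) => u k n j ω) μ)
    {k : ℕ} (lt : Fin k → Letter r) (hlt : ∀ p, (lt p).IsSummable) (δ : Bool) :
    ∃ L : ℂ, Tendsto (fun n : ℕ => expTrace μ (fun ω =>
      (List.ofFn fun p => toeplitz ((lt p).coef u n ω) n).prod * backwardPow δ n))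
      atTop (𝓝 L) := by
  classical
  have hκ : ∀ p : {p // (lt p).IsRand = true}, ∃ κ : Fin r × Bool × Bool,
      lt p = .rand κ.1 κ.2.1 κ.2.2 := by
    rintro ⟨p, hp⟩
    rcases h : lt p with ⟨k, s, c⟩ | d
    · exact ⟨(k, s, c), rfl⟩
    · rw [h] at hp
      exact absurd hp (by simp [Letter.IsRand])
  have hd : ∀ p : {p // ¬ (lt p).IsRand = true}, ∃ d : ℤ → ℂ, lt p = .det d := by
    rintro ⟨p, hp⟩
    rcases h : lt p with ⟨k, s, c⟩ | d
    · rw [h] at hp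
      exact absurd hp (by simp [Letter.IsRand])
    · exact ⟨d, rfl⟩
  choose κ hκ using hκ
  choose d hd using hd
  have hdsum : ∀ p, Summable fun v => ‖d p v‖ := by
    intro p
    have := hlt p
    rw [hd p] at this
    exact this
  have hE := isMomentFunction_jointMoment hu hindep κ
  obtain ⟨K, hK⟩ := hE.exists_bound
  let Q : ({p // ¬ (lt p).IsRand = true} → ℤ) → ℕ →
      (Option {p // (lt p).IsRand = true} → ℤ) → Prop := fun w n x =>
    IsClosedPath n δ (List.ofFn (glue (fun p => x (some p)) w)) (x none)
  -- The fixed deterministic steps enter as constant terms of the affine forms.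
  have hQ : ∀ w, IsPoly (Q w) := by
    intro w
    refine isPoly_isClosedPath δ (g := fun p _ x => glue (fun p => x (some p)) w p)
      (fun p => ?_) (IsAffine.coord none)
    by_cases h : (lt p).IsRand = true
    · simpa only [glue, dif_pos h] using
        IsAffine.coord (some (⟨p, h⟩ : {p // (lt p).IsRand = true}))
    · simpa only [glue, dif_neg h] using IsAffine.const _
  choose L hL using fun w => hE.tendsto_momentSum (hQ w)
  -- Extension by zero outside the cube puts all `n` on one index set; each fixed `w` is eventually
  -- in the cube.
  let F : ℕ → ({p // ¬ (lt p).IsRand = true} → ℤ) → ℂ := fun n w =>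
    if w ∈ box _ n then (∏ p, d p (w p)) * momentSum (jointMoment μ u κ) n (Q w n) else 0
  have hF : Tendsto (fun n => ∑' w, F n w) atTop (𝓝 (∑' w, (∏ p, d p (w p)) * L w)) := by
    refine tendsto_tsum_of_dominated_convergence
      ((summable_prod_pi (fun p v => norm_nonneg (d p v)) hdsum).mul_right K) ?_ ?_
    · intro w
      refine ((hL w).const_mul _).congr' ?_
      filter_upwards [eventually_ge_atTop (∑ p, (w p).natAbs)] with n hn
      refine (if_pos (mem_box.2 fun p => ?_)).symm
      have := Finset.single_le_sum (f := fun p => (w p).natAbs) (fun p _ => Nat.zero_le _)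
        (Finset.mem_univ p)
      omega
    · filter_upwards [eventually_ge_atTop 1] with n hn w
      have hK0 : 0 ≤ K := (norm_nonneg _).trans (hK n hn (Q w n))
      simp only [F]
      split_ifs
      · rw [norm_mul, norm_prod]
        gcongr
        exact hK n hn _
      · rw [norm_zero]
        positivity
  refine ⟨_, hF.congr' ?_⟩
  filter_upwards [eventually_ge_atTop 1] with n hn
  rw [expTrace_prod_eq hu lt δ κ hκ d hd hn, tsum_eq_sum (s := box _ n)
    fun w hw => if_neg hw]
  exact Finset.sum_congr rfl fun w hw => if_pos hw

theorem HasNormalForm.tendsto_expTrace (hu : ∀ k, IsPairCorrelated μ (u k) (q k))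
    (hindep : ∀ n, 1 ≤ n → iIndepFun (fun (k : Fin r) (ω : Ω) (j : ℤ) => u k n j ω) μ)
    {A : (n : ℕ) → Ω → Matrix (Fin n) (Fin n) ℂ} (hA : HasNormalForm u A) :
    ∃ L : ℂ, Tendsto (fun n : ℕ => expTrace μ (A n)) atTop (𝓝 L) := by
  obtain ⟨ls, δ, hls, hA⟩ := hA
  obtain ⟨L, hL⟩ := tendsto_expTrace_prod hu hindep ls.get
    (fun p => hls _ (List.get_mem ls p)) δ
  refine ⟨L, hL.congr fun n => ?_⟩
  congr 1
  funext ω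
  rw [hA]
  congr 2
  conv_rhs => rw [← List.ofFn_get ls, List.map_ofFn]
  rfl

theorem hasAllMoments_toeplitz {Ω : Type*} [MeasurableSpace Ω] {μ : Measure Ω} {n : ℕ} {a : ℤ → Ω → ℂ} (ha : ∀ j, HasMoments μ (a j)) :
    HasAllMoments μ fun ω => toeplitz (fun j => a j ω) n :=
  fun i j => ha (((i : ℕ) : ℤ) - ((j : ℕ) : ℤ))

theorem hasAllMoments_collection (hu : ∀ k, IsPairCorrelated μ (u k) (q k)) {m : ℕ}
    (t h : Fin m → Fin r) (d e : Fin m → ℤ → ℂ) (l : Label m) {n : ℕ} (hn : 1 ≤ n) :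
    HasAllMoments μ (collection (fun i => u (t i)) (fun i => u (h i)) d e l n) := by
  rcases l with i | i | i | i | _
  · exact (hasAllMoments_toeplitz fun j => (hu (t i)).hasMoments hn j).smul _
  · exact ((HasAllMoments.const (backwardIdentity n)).mul
      (hasAllMoments_toeplitz fun j => (hu (h i)).hasMoments hn j)).smul _
  · exact HasAllMoments.const _
  · exact HasAllMoments.const _
  · exact HasAllMoments.const _

end Words

end ToeplitzHankel

end

/-- `u 0, …, u (r - 1)` are independent input arrays, each satisfying the pair-correlation
assumption. The `i`-th random Toeplitz matrix has input `u (t i)` and the `i`-th random symmetric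
Hankel matrix has input `u (h i)`; as `t` and `h` are injective, each of these two families consists
of independent matrices. The two families are independent of each other if `t` and `h` have disjoint
ranges, and are allowed to share inputs otherwise. -/
theorem corollary2p1 {Ω : Type*} [MeasurableSpace Ω] (μ : MeasureTheory.Measure Ω)
    [MeasureTheory.IsProbabilityMeasure μ] (r m : ℕ)
    (u : Fin r → ℕ → ℤ → Ω → ℂ) (q : Fin r → ToeplitzHankel.CorrParams)
    (hu : ∀ k, ToeplitzHankel.IsPairCorrelated μ (u k) (q k))
    (hindep : ∀ n, 1 ≤ n →
      ProbabilityTheory.iIndepFun (fun (k : Fin r) (ω : Ω) (j : ℤ) => u k n j ω) μ)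
    (t h : Fin m → Fin r) (ht : Function.Injective t) (hh : Function.Injective h)
    (d e : Fin m → ℤ → ℂ)
    (hd : ∀ i, Summable fun k => ‖d i k‖) (he : ∀ i, Summable fun k => ‖e i k‖) :
    ToeplitzHankel.ConvergeJointly μ
      (ToeplitzHankel.collection (fun i => u (t i)) (fun i => u (h i)) d e) := by
  exact ToeplitzHankel.convergeJointly_of_tendsto
    (fun l _ hn => ToeplitzHankel.hasAllMoments_collection hu t h d e l hn)
    fun w => (ToeplitzHankel.hasNormalForm_starWord t h d e hd he w).tendsto_expTrace hu hindep
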